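/- Conventions. For a finite graph $G=(V,E)$ and an Abelian group $\Gamma$ of order $|E|$, a $\Gamma$-harmonious labeling of $G$ is an injection $f:V\to\Gamma$ for which the induced edge labeling $w:E\to\Gamma$, $w(xy)=f(x)+f(y)$, is a bijection. The generalized prism $Y_{m,n}$ is the Cartesian product of the path $P_m$ and the cycle $C_n$; its $n$-cycles corresponding to the first and to the last vertex of $P_m$ are called the top and the bottom cycle. The generalized closed web $CW_{m,n}$ arises from $Y_{m,n}$ by adding a new vertex and joining it by an edge to every vertex of the top cycle. The generalized open web $OW_{m,n}$ arises from $CW_{m,n}$ by removing the edges of the bottom cycle. Theorem. Let $n\ge 3$, $m\ge 2$, and let $\Gamma$ be an Abelian group of order $(2m-1)n$. Suppose that $\Gamma$ has a subgroup $H$ of order $n$ such that the quotient group $\Gamma/H$ is cyclic and such that 1. $n$ is odd, or 2. $n$ is even and $H$ has a subgroup isomorphic to $\mathbb{Z}_2\oplus\mathbb{Z}_{2s}$ for some $s\ge 2$. Then $OW_{m,n}$ admits a $\Gamma$-harmonious labeling. -/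

import Mathlib

namespace GammaHarmonious

/-- The edge label induced by a vertex labelling `f`: the edge `xy` gets `f x + f y`. -/
def edgeLabel {V Γ : Type*} [AddCommGroup Γ] (f : V → Γ) : Sym2 V → Γ :=
  Sym2.lift ⟨fun x y => f x + f y, fun x y => add_comm (f x) (f y)⟩

/-- `f` is a `Γ`-harmonious labelling of `G`: it is injective on the vertices and the induced
edge labelling is a bijection from the edge set of `G` onto `Γ`. -/
def IsHarmoniousLabeling {V Γ : Type*} [AddCommGroup Γ] (G : SimpleGraph V) (f : V → Γ) : Prop :=
  Function.Injective f ∧ Function.Bijective (fun e : G.edgeSet => edgeLabel f (e : Sym2 V))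

/-- `G` is `Γ`-harmonious. -/
def IsHarmonious {V : Type*} (G : SimpleGraph V) (Γ : Type*) [AddCommGroup Γ] : Prop :=
  ∃ f : V → Γ, IsHarmoniousLabeling G f

/-- The generalized prism `Y_{m,n}`, the Cartesian product of the path `P_m` and the cycle `C_n`.
The top cycle is the one with first coordinate `0`, the bottom cycle the one with first
coordinate `m - 1`. -/
def generalizedPrism (m n : ℕ) : SimpleGraph (Fin m × Fin n) :=
  (SimpleGraph.pathGraph m).boxProd (SimpleGraph.cycleGraph n)

/-- The generalized closed web `CW_{m,n}`: the generalized prism together with a new vertex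
`none`, joined to every vertex of the top cycle. -/
def generalizedClosedWeb (m n : ℕ) : SimpleGraph (Option (Fin m × Fin n)) where
  Adj
    | none, none => False
    | none, some y => (y.1 : ℕ) = 0
    | some x, none => (x.1 : ℕ) = 0
    | some x, some y => (generalizedPrism m n).Adj x y
  symm := ⟨by
    rintro (_ | x) (_ | y) h
    · exact h
    · exact h
    · exact h
    · exact SimpleGraph.Adj.symm (G := generalizedPrism m n) h⟩
  loopless := ⟨by
    rintro (_ | x) h
    · exact h
    · exact SimpleGraph.irrefl (generalizedPrism m n) h⟩

/-- The edges of the bottom cycle, as edges of the closed web: those with both end vertices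
`(i, a)`, `(i, b)` on the level `i = m - 1`, where `a` and `b` are adjacent in `C_n`. -/
def bottomCycleEdges (m n : ℕ) : Set (Sym2 (Option (Fin m × Fin n))) :=
  {e | ∃ (i : Fin m) (a b : Fin n), (i : ℕ) + 1 = m ∧ (SimpleGraph.cycleGraph n).Adj a b ∧
    e = s(some (i, a), some (i, b))}

/-- The generalized open web `OW_{m,n}`: the generalized closed web without the edges of the
bottom cycle. -/
def generalizedOpenWeb (m n : ℕ) : SimpleGraph (Option (Fin m × Fin n)) :=
  (generalizedClosedWeb m n).deleteEdges (bottomCycleEdges m n)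

/-- The condition on an abelian group `H` of order `n`: either `n` is odd, or `n` is even and
`H` has a subgroup isomorphic to `Z_2 ⊕ Z_{2s}` for some `s ≥ 2`. -/
def CycleCondition (n : ℕ) (H : Type*) [AddCommGroup H] : Prop :=
  Nat.card H = n ∧
    (Odd n ∨
      (Even n ∧ ∃ s : ℕ, 2 ≤ s ∧ ∃ L : AddSubgroup H, Nonempty (L ≃+ ZMod 2 × ZMod (2 * s))))

end GammaHarmonious

/-!
Let `t` generate the cyclic quotient `Γ ⧸ H`, which has odd order `2 * m - 1`, and arrange the
elements of `H` in a circle so that the sums of neighbours are again all the elements of `H`.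
Put this circle into the coset `i • t + H` on level `i` of the web, turned by one step with respect
to the previous level, and give the apex the label `(2 * m - 2) • t`. The edges of level `i` then
fill the coset `2 * i • t + H`, those between levels `i` and `i + 1` the coset
`(2 * i + 1) • t + H`, and those at the apex the remaining one.

Circular arrangements of `H` exist, by Beals, Gallian, Headley and Jungreis, when `H` has odd order
or when it has more than two elements annihilated by `2` and at least one which is not. The proof
is by induction on the order. An arrangement of `G ⧸ K` lifts to `G` if the fibres over successive
points are matched by translates of complete mappings of `K` whose composite round the circle is a
single cycle; this is possible for `K` cyclic of odd order, and, when `G ⧸ K` has even order, for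
`K` isomorphic to `(ZMod 2)⁴` or `ZMod 2 × ZMod 4`. The groups in which no such `K` leaves the
hypothesis on `G ⧸ K` intact are an elementary abelian `2`-group times a group of odd prime order
and a few `2`-groups, and for these the arrangement is written down.
-/

namespace GammaHarmonious

open Function Equiv
open AddSubgroup (zmultiples)

section HarmoniousGroup

variable {α β G : Type*} [AddCommGroup G]

theorem isCycleOn_univ_of_sameCycle {σ : Perm α} (a : α) (h : ∀ x, σ.SameCycle a x) :
    σ.IsCycleOn Set.univ :=
  ⟨σ.bijective.bijOn_univ, fun x _ y _ => (h x).symm.trans (h y)⟩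

theorem isCycleOn_univ_addRight {g : G} (hg : ∀ x, x ∈ zmultiples g) :
    (Equiv.addRight g).IsCycleOn Set.univ := by
  refine isCycleOn_univ_of_sameCycle 0 fun x => ?_
  obtain ⟨n, rfl⟩ := AddSubgroup.mem_zmultiples_iff.1 (hg x)
  exact ⟨n, by simp [Equiv.zsmul_addRight]⟩

theorem semiconj_zpow {τ : Perm α} {σ : Perm β} {f : α → β} (h : Semiconj f τ σ) (n : ℤ) :
    Semiconj f ⇑(τ ^ n) ⇑(σ ^ n) := by
  have hpow (n : ℕ) : Semiconj f ⇑(τ ^ n) ⇑(σ ^ n) := by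
    simpa only [Perm.coe_pow] using h.iterate_right n
  obtain n | n := n
  · exact hpow n
  · rw [zpow_negSucc, zpow_negSucc]
    exact (hpow (n + 1)).inverses_right (τ ^ (n + 1)).right_inv (σ ^ (n + 1)).left_inv

theorem sameCycle_of_semiconj {τ : Perm α} {σ : Perm β} {f : α → β} (h : Semiconj f τ σ) {x y : α}
    (hxy : τ.SameCycle x y) : σ.SameCycle (f x) (f y) := by
  obtain ⟨n, rfl⟩ := hxy
  exact ⟨n, (semiconj_zpow h n x).symm⟩

theorem isCycleOn_univ_of_semiconj {τ : Perm α} {σ : Perm β} {f : α → β} (hf : Surjective f)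
    (h : Semiconj f τ σ) (hτ : τ.IsCycleOn Set.univ) : σ.IsCycleOn Set.univ := by
  refine ⟨σ.bijective.bijOn_univ, fun x _ y _ => ?_⟩
  obtain ⟨i, rfl⟩ := hf x
  obtain ⟨j, rfl⟩ := hf y
  exact sameCycle_of_semiconj h (hτ.2 (Set.mem_univ i) (Set.mem_univ j))

/-- A finite abelian group is harmonious if its elements can be arranged in a cycle in such a way
that the sums of two consecutive elements are distinct (Beals, Gallian, Headley and Jungreis).
The permutation `σ` maps every element to its successor. -/
def IsHarmoniousGroup (G : Type*) [AddCommGroup G] : Prop :=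
  ∃ σ : Perm G, σ.IsCycleOn Set.univ ∧ Injective fun x => x + σ x

theorem IsHarmoniousGroup.of_listing {τ : Perm α} (hτ : τ.IsCycleOn Set.univ)
    {v : α → G} (hv : Bijective v) (hadd : Injective fun i => v i + v (τ i)) :
    IsHarmoniousGroup G := by
  set e := Equiv.ofBijective v hv
  have hsemi : Semiconj v τ (e.permCongr τ) := fun i => by
    simp only [permCongr_apply, e, ofBijective_symm_apply_apply]; rfl
  refine ⟨e.permCongr τ, isCycleOn_univ_of_semiconj hv.surjective hsemi hτ, fun x y hxy => ?_⟩
  obtain ⟨i, rfl⟩ := hv.surjective x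
  obtain ⟨j, rfl⟩ := hv.surjective y
  simp only [← hsemi.eq] at hxy
  rw [hadd hxy]

theorem isCycleOn_univ_addRight_one (n : ℕ) :
    (Equiv.addRight (1 : ZMod n)).IsCycleOn Set.univ :=
  isCycleOn_univ_addRight fun x => ⟨x.cast, by simp⟩

theorem IsHarmoniousGroup.of_zmod_listing {n : ℕ} [NeZero n] {v : ZMod n → G} (hv : Bijective v)
    (hadd : Injective fun i => v i + v (i + 1)) : IsHarmoniousGroup G :=
  .of_listing (isCycleOn_univ_addRight_one n) hv hadd

theorem IsHarmoniousGroup.of_nat_listing {n : ℕ} [NeZero n] (hn : Nat.card G = n) {h : ℕ → G}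
    (hper : h n = h 0) (hinj : Set.InjOn h (Set.Iio n))
    (hadd : Set.InjOn (fun i => h i + h (i + 1)) (Set.Iio n)) : IsHarmoniousGroup G := by
  have hG : Finite G := Nat.finite_of_card_ne_zero (hn ▸ NeZero.ne n)
  have hsucc (i : ZMod n) : h (i + 1).val = h (i.val + 1) := by
    have hval : (i + 1).val = (i.val + 1) % n := by
      simp [ZMod.val_add, ZMod.val_one_eq_one_mod]
    rcases (Nat.succ_le_of_lt i.val_lt).lt_or_eq with hlt | heq
    · rw [hval, Nat.mod_eq_of_lt hlt]
    · rw [hval, ← Nat.succ_eq_add_one, heq, Nat.mod_self, hper]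
  have hv : Injective fun i : ZMod n => h i.val := fun i j hij =>
    ZMod.val_injective n (hinj i.val_lt j.val_lt hij)
  refine .of_zmod_listing (v := fun i : ZMod n => h i.val)
    ((Nat.bijective_iff_injective_and_card _).2 ⟨hv, by simp [hn]⟩) fun i j hij => ?_
  simp only [hsucc] at hij
  exact ZMod.val_injective n (hadd i.val_lt j.val_lt hij)

theorem IsHarmoniousGroup.congr {G' : Type*} [AddCommGroup G'] (e : G ≃+ G')
    (h : IsHarmoniousGroup G) : IsHarmoniousGroup G' := by
  obtain ⟨σ, hσ, hadd⟩ := h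
  refine .of_listing hσ e.bijective fun x y hxy => hadd ?_
  simpa only [← map_add, e.injective.eq_iff] using hxy

end HarmoniousGroup

section CompleteMapping

variable {K : Type*} [AddCommGroup K]

/-- A complete mapping of an abelian group: a permutation `θ` such that `x ↦ x + θ x` is
injective. -/
def IsCompleteMapping (θ : Perm K) : Prop :=
  Injective fun x => x + θ x

theorem IsCompleteMapping.inv {θ : Perm K} (hθ : IsCompleteMapping θ) :
    IsCompleteMapping θ⁻¹ := fun x y hxy => θ⁻¹.injective (hθ (by simpa [add_comm] using hxy))

theorem isCompleteMapping_iff_of_listing {α : Type*} {θ : Perm K} {u v : α → K}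
    (hu : Bijective u) (h : ∀ i, θ (u i) = v i) :
    IsCompleteMapping θ ↔ Injective fun i => u i + v i := by
  simp only [← h, IsCompleteMapping]
  exact (Injective.of_comp_iff' _ hu).symm

/-- `K` has a complete cycle of length `k` if some product of `k` complete mappings of `K` permutes
`K` cyclically. For a subgroup `K` this is what allows one to lift a harmonious arrangement from the
quotient by `K` if this quotient has order `k`, see `IsHarmoniousGroup.of_quotient`. -/
def HasCompleteCycle (K : Type*) [AddCommGroup K] (k : ℕ) : Prop :=
  ∃ l : List (Perm K), l.length = k ∧ (∀ θ ∈ l, IsCompleteMapping θ) ∧ l.prod.IsCycleOn Set.univ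

theorem HasCompleteCycle.add_two {k : ℕ} (h : HasCompleteCycle K (k + 1)) :
    HasCompleteCycle K (k + 3) := by
  obtain ⟨_ | ⟨θ, l⟩, hlen, hθ, hcyc⟩ := h
  · simp at hlen
  · refine ⟨θ :: θ⁻¹ :: θ :: l, by simpa using hlen, ?_, by simpa using hcyc⟩
    simp only [List.mem_cons, forall_eq_or_imp] at hθ ⊢
    exact ⟨hθ.1, hθ.1.inv, hθ.1, hθ.2⟩

theorem HasCompleteCycle.of_even {k : ℕ} (h : HasCompleteCycle K 2) (hk : Even k) (hk0 : k ≠ 0) :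
    HasCompleteCycle K k := by
  obtain ⟨j, rfl⟩ : ∃ j, k = 2 * j + 2 := ⟨k / 2 - 1, by grind⟩
  induction j with
  | zero => exact h
  | succ j ih => exact (ih (by grind) (by simp)).add_two

theorem HasCompleteCycle.of_odd {k : ℕ} (h : HasCompleteCycle K 3) (hk : Odd k) (hk1 : k ≠ 1) :
    HasCompleteCycle K k := by
  obtain ⟨j, rfl⟩ : ∃ j, k = 2 * j + 3 := ⟨k / 2 - 1, by grind⟩
  induction j with
  | zero => exact h
  | succ j ih => exact (ih (by simp [parity_simps]) (by simp)).add_two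

theorem HasCompleteCycle.congr {K' : Type*} [AddCommGroup K'] {k : ℕ} (e : K ≃+ K')
    (h : HasCompleteCycle K k) : HasCompleteCycle K' k := by
  obtain ⟨l, hlen, hθ, hcyc⟩ := h
  refine ⟨l.map e.toEquiv.permCongrHom, by simpa using hlen, ?_, ?_⟩
  · simp only [List.mem_map, forall_exists_index, and_imp]
    rintro _ θ hmem rfl x y hxy
    apply e.symm.injective
    apply hθ θ hmem
    simpa using congrArg e.symm hxy
  · rw [← map_list_prod]
    exact isCycleOn_univ_of_semiconj e.surjective (fun x => by simp) hcyc

theorem exists_completeMapping_list_of_listings {α : Type*} {k : ℕ} (u : Fin (k + 1) → α → K)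
    (hu : ∀ i, Bijective (u i))
    (hadd : ∀ i : Fin k, Injective fun a => u i.castSucc a + u i.succ a) :
    ∃ l : List (Perm K), l.length = k ∧ (∀ θ ∈ l, IsCompleteMapping θ) ∧
      ∀ a, l.prod (u 0 a) = u (Fin.last k) a := by
  induction k with
  | zero => exact ⟨[], by simp⟩
  | succ k ih =>
    obtain ⟨l, hlen, hθ, hprod⟩ :=
      ih (fun i => u i.castSucc) (fun i => hu _) fun i => hadd i.castSucc
    set θ : Perm K :=
      (Equiv.ofBijective _ (hu (Fin.last k).castSucc)).symm.trans (.ofBijective _ (hu (Fin.last _)))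
    have hθu (a : α) : θ (u (Fin.last k).castSucc a) = u (Fin.last _) a := by
      simp only [θ, trans_apply, ofBijective_symm_apply_apply, ofBijective_apply]
    refine ⟨θ :: l, by simp [hlen], ?_, fun a => ?_⟩
    · simpa only [List.forall_mem_cons, isCompleteMapping_iff_of_listing (hu _) hθu] using
        ⟨hadd (Fin.last k), hθ⟩
    · rw [List.prod_cons, Perm.mul_apply, ← hθu, ← hprod, Fin.castSucc_zero]

theorem HasCompleteCycle.of_listings {α : Type*} {τ : Perm α} (hτ : τ.IsCycleOn Set.univ) {k : ℕ}
    (u : Fin (k + 1) → α → K) (hu : ∀ i, Bijective (u i))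
    (hadd : ∀ i : Fin k, Injective fun a => u i.castSucc a + u i.succ a)
    (hlast : ∀ a, u (Fin.last k) a = u 0 (τ a)) : HasCompleteCycle K k := by
  obtain ⟨l, hlen, hθ, hprod⟩ := exists_completeMapping_list_of_listings u hu hadd
  exact ⟨l, hlen, hθ, isCycleOn_univ_of_semiconj (hu 0).surjective
    (fun a => by rw [hprod, hlast]) hτ⟩

theorem isCompleteMapping_addRight (hK : Odd (Nat.card K)) (g : K) :
    IsCompleteMapping (Equiv.addRight g) := by
  have hinj : Injective fun x : K => 2 • x :=
    (nsmulCoprime (Nat.coprime_two_right.2 hK)).injective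
  exact fun x y hxy => hinj (by simpa [two_nsmul, ← add_assoc] using hxy)

theorem hasCompleteCycle_of_isAddCyclic [IsAddCyclic K] (hK : Odd (Nat.card K)) {k : ℕ}
    (hk : k ≠ 0) : HasCompleteCycle K k := by
  obtain ⟨g, hg⟩ := IsAddCyclic.exists_generator (α := K)
  obtain ⟨k, rfl⟩ := Nat.exists_eq_succ_of_ne_zero hk
  have hone := isCompleteMapping_addRight hK 0
  rw [Equiv.addRight_zero] at hone
  refine ⟨Equiv.addRight g :: List.replicate k 1, by simp, ?_,
    by simpa using isCycleOn_univ_addRight hg⟩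
  simp only [List.mem_cons, List.mem_replicate]
  rintro θ (rfl | ⟨-, rfl⟩)
  exacts [isCompleteMapping_addRight hK g, hone]

end CompleteMapping

section Quotient

variable {α β : Type*}

theorem exists_prodShear_pow_eq [Finite α] {σ : Perm α} (hσ : σ.IsCycleOn Set.univ) (a : α)
    (l : List (Perm β)) (hl : l.length = Nat.card α) :
    ∃ θ : α → Perm β, (∀ i, θ i ∈ l) ∧
      ∀ b, (prodShear σ θ ^ Nat.card α) (a, b) = (a, l.prod b) := by
  cases nonempty_fintype α
  rw [← Finset.coe_univ] at hσ
  rw [Nat.card_eq_fintype_card, ← Finset.card_univ] at hl ⊢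
  choose idx hlt hidx using fun i => hσ.exists_pow_eq (Finset.mem_univ a) (Finset.mem_univ i)
  have hidx_pow {n : ℕ} (hn : n < l.length) : idx ((σ ^ n) a) = n :=
    ((hσ.pow_apply_eq_pow_apply (Finset.mem_univ a)).1 (hidx _)).eq_of_lt_of_lt (hlt _) (hl ▸ hn)
  set θ : α → Perm β := fun i => l[l.length - 1 - idx i]'(by grind)
  have hpow (b : β) (n : ℕ) (hn : n ≤ l.length) :
      (prodShear σ θ ^ n) (a, b) =
        ((σ ^ n) a, (l.drop (l.length - n)).prod b) := by
    induction n with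
    | zero => simp
    | succ n ih =>
      have hdrop : l.drop (l.length - (n + 1)) =
          θ ((σ ^ n) a) :: l.drop (l.length - n) := by
        rw [List.drop_eq_getElem_cons (by omega)]
        simp only [θ, hidx_pow hn]
        grind
      rw [pow_succ', Perm.mul_apply, ih (by omega), prodShear_apply, hdrop, pow_succ',
        Perm.mul_apply, List.prod_cons, Perm.mul_apply]
  refine ⟨θ, fun i => List.getElem_mem _, fun b => ?_⟩
  rw [← hl, hpow b _ le_rfl, Nat.sub_self, List.drop_zero, hl,
    hσ.pow_card_apply (Finset.mem_univ a)]

theorem isCycleOn_univ_prodShear {σ : Perm α} (hσ : σ.IsCycleOn Set.univ) {θ : α → Perm β}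
    {π : Perm β} (hπ : π.IsCycleOn Set.univ) {k : ℕ} (a : α)
    (h : ∀ b, (prodShear σ θ ^ k) (a, b) = (a, π b)) :
    Perm.IsCycleOn (prodShear σ θ) Set.univ := by
  have hfiber (b c : β) : Perm.SameCycle (prodShear σ θ) (a, b) (a, c) :=
    (sameCycle_of_semiconj (f := (a, ·)) (fun b => (h b).symm)
      (hπ.2 (Set.mem_univ b) (Set.mem_univ c))).of_pow
  have hbase (x : α × β) : ∃ b, Perm.SameCycle (prodShear σ θ) x (a, b) := by
    obtain ⟨n, hn⟩ := hσ.2 (Set.mem_univ x.1) (Set.mem_univ a)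
    have hfst := semiconj_zpow (τ := prodShear σ θ) (σ := σ) (f := Prod.fst) (fun x => rfl) n x
    exact ⟨_, n, Prod.ext (hfst.trans hn) rfl⟩
  refine ⟨(Equiv.bijective _).bijOn_univ, fun x _ y _ => ?_⟩
  obtain ⟨b, hb⟩ := hbase x
  obtain ⟨c, hc⟩ := hbase y
  exact (hb.trans (hfiber b c)).trans hc.symm

theorem bijective_out_add {G : Type*} [AddCommGroup G] (K : AddSubgroup G) :
    Bijective fun x : (G ⧸ K) × K => x.1.out + (x.2 : G) := by
  refine ⟨fun x y hxy => ?_, fun g => ?_⟩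
  · have h1 : x.1 = y.1 := by
      simpa using congrArg (QuotientAddGroup.mk (s := K)) hxy
    exact Prod.ext h1 (Subtype.ext (by simpa [h1] using hxy))
  · have hmem : -(g : G ⧸ K).out + g ∈ K := QuotientAddGroup.eq.1 (by simp)
    exact ⟨(g, ⟨_, hmem⟩), by simp⟩

theorem eq_and_eq_of_nsmul_add_eq {G : Type*} [AddCommGroup G] {H : AddSubgroup G} {t : G} {a b : ℕ}
    (ha : a < addOrderOf (t : G ⧸ H)) (hb : b < addOrderOf (t : G ⧸ H)) {x y : H}
    (h : a • t + (x : G) = b • t + (y : G)) : a = b ∧ x = y := by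
  have hab : a • (t : G ⧸ H) = b • (t : G ⧸ H) := by
    simpa using congrArg (QuotientAddGroup.mk (s := H)) h
  obtain rfl := nsmul_injOn_Iio_addOrderOf ha hb hab
  exact ⟨rfl, Subtype.ext (add_left_cancel h)⟩

theorem IsHarmoniousGroup.of_quotient {G : Type*} [AddCommGroup G] [Finite G] (K : AddSubgroup G)
    (hQ : IsHarmoniousGroup (G ⧸ K)) (hK : HasCompleteCycle K (Nat.card (G ⧸ K))) :
    IsHarmoniousGroup G := by
  obtain ⟨σ, hσ, hadd⟩ := hQ
  obtain ⟨l, hlen, hl, hcyc⟩ := hK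
  obtain ⟨θ, hθ, hpow⟩ := exists_prodShear_pow_eq hσ 0 l hlen
  refine .of_listing (isCycleOn_univ_prodShear hσ hcyc 0 hpow) (bijective_out_add K)
    fun x y hxy => ?_
  simp only [prodShear_apply] at hxy
  have h1 : x.1 = y.1 := hadd (by simpa using congrArg (QuotientAddGroup.mk (s := K)) hxy)
  refine Prod.ext h1 (hl _ (hθ y.1) (Subtype.ext ?_))
  rw [h1, add_add_add_comm, add_add_add_comm _ (y.2 : G)] at hxy
  exact add_left_cancel hxy

end Quotient

section OddOrder

theorem IsHarmoniousGroup.of_subsingleton {G : Type*} [AddCommGroup G] [Subsingleton G] :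
    IsHarmoniousGroup G :=
  ⟨1, Perm.isCycleOn_of_subsingleton _ _, injective_of_subsingleton _⟩

theorem card_quotient_lt {G : Type*} [AddCommGroup G] [Finite G] {K : AddSubgroup G}
    (hK : K ≠ ⊥) : Nat.card (G ⧸ K) < Nat.card G := by
  have h1 : 1 < Nat.card K := K.one_lt_card_iff_ne_bot.2 hK
  rw [K.card_eq_card_quotient_mul_card_addSubgroup]
  exact lt_mul_of_one_lt_right Nat.card_pos h1

theorem IsHarmoniousGroup.of_odd_card {G : Type*} [AddCommGroup G] (hG : Odd (Nat.card G)) :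
    IsHarmoniousGroup G := by
  induction hn : Nat.card G using Nat.strong_induction_on generalizing G with
  | _ n ih =>
    subst hn
    have hfin : Finite G := Nat.finite_of_card_ne_zero hG.pos.ne'
    rcases subsingleton_or_nontrivial G with _ | _
    · exact .of_subsingleton
    · obtain ⟨g, hg⟩ := exists_ne (0 : G)
      have hmul := (zmultiples g).card_eq_card_quotient_mul_card_addSubgroup
      rw [hmul, Nat.odd_mul] at hG
      have hlt := card_quotient_lt (mt AddSubgroup.zmultiples_eq_bot.1 hg)
      exact .of_quotient _ (ih _ hlt hG.1 rfl)
        (hasCompleteCycle_of_isAddCyclic hG.2 Nat.card_pos.ne')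

end OddOrder

section SmallGroups

/-- The vector of the last `j` binary digits of `c`, used to write down listings of
`Fin j → ZMod 2`. -/
def binaryVec (j c : ℕ) : Fin j → ZMod 2 :=
  fun i => if c.testBit i then 1 else 0

/-- A listing of `ZMod 2 × ZMod 4` showing that this group is harmonious. -/
def listingEight : ZMod 8 → ZMod 2 × ZMod 4 :=
  ![(0, 0), (0, 1), (0, 2), (1, 0), (1, 2), (0, 3), (1, 1), (1, 3)]

theorem isHarmoniousGroup_zmod_two_prod_zmod_four : IsHarmoniousGroup (ZMod 2 × ZMod 4) :=
  .of_zmod_listing (v := listingEight) (by decide +kernel) (by decide +kernel)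

theorem hasCompleteCycle_zmod_two_prod_zmod_four : HasCompleteCycle (ZMod 2 × ZMod 4) 2 := by
  let w : ZMod 8 → ZMod 2 × ZMod 4 :=
    ![(0, 0), (0, 2), (1, 3), (0, 3), (1, 0), (1, 1), (0, 1), (1, 2)]
  exact .of_listings (isCycleOn_univ_addRight_one 8)
    ![listingEight, w, fun i => listingEight (i + 1)]
    (by decide +kernel) (by decide +kernel) fun _ => rfl

/-- A listing of `Fin 4 → ZMod 2`, the additive group of the field with 16 elements. -/
def listingSixteen (i : ZMod 16) : Fin 4 → ZMod 2 :=
  binaryVec 4 (![0, 2, 12, 3, 6, 7, 4, 13, 14, 8, 11, 10, 9, 1, 5, 15] i)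

/-- Multiplication by `X` in the field `𝔽₂[X] / (X ^ 4 + X + 1)`. -/
def mulXSixteen (c : Fin 4 → ZMod 2) : Fin 4 → ZMod 2 :=
  ![c 3, c 0 + c 3, c 1, c 2]

theorem hasCompleteCycle_two_sixteen : HasCompleteCycle (Fin 4 → ZMod 2) 2 :=
  .of_listings (isCycleOn_univ_addRight_one 16)
    ![listingSixteen, fun i => mulXSixteen (mulXSixteen (listingSixteen i)),
      fun i => listingSixteen (i + 1)]
    (by decide +kernel) (by decide +kernel) fun _ => rfl

theorem hasCompleteCycle_three_sixteen : HasCompleteCycle (Fin 4 → ZMod 2) 3 :=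
  .of_listings (isCycleOn_univ_addRight_one 16)
    ![listingSixteen, fun i => mulXSixteen (listingSixteen i),
      fun i => mulXSixteen (mulXSixteen (listingSixteen i)),
      fun i => listingSixteen (i + 1)]
    (by decide +kernel) (by decide +kernel) fun _ => rfl

/-- A listing of `Fin 5 → ZMod 2`, the additive group of the field with 32 elements. -/
def listingThirtyTwo (i : ZMod 32) : Fin 5 → ZMod 2 :=
  binaryVec 5 (![0, 4, 14, 31, 21, 5, 25, 22, 7, 27, 8, 6, 24, 3, 2, 17, 30, 15, 11, 1, 23, 12, 28,
    26, 19, 9, 29, 10, 18, 20, 13, 16] i)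

/-- Multiplication by `X` in the field `𝔽₂[X] / (X ^ 5 + X ^ 2 + 1)`. -/
def mulXThirtyTwo (c : Fin 5 → ZMod 2) : Fin 5 → ZMod 2 :=
  ![c 4, c 0, c 1 + c 4, c 2, c 3]

theorem hasCompleteCycle_three_thirtyTwo : HasCompleteCycle (Fin 5 → ZMod 2) 3 :=
  .of_listings (isCycleOn_univ_addRight_one 32)
    ![listingThirtyTwo, fun i => mulXThirtyTwo (listingThirtyTwo i),
      fun i => mulXThirtyTwo (mulXThirtyTwo (listingThirtyTwo i)),
      fun i => listingThirtyTwo (i + 1)]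
    (by decide +kernel) (by decide +kernel) fun _ => rfl

theorem isHarmoniousGroup_zmod_four_prod_binary_three :
    IsHarmoniousGroup (ZMod 4 × (Fin 3 → ZMod 2)) := by
  let c : ZMod 32 → ℕ := ![0, 4, 14, 25, 15, 31, 27, 9, 29, 30, 18, 3, 26, 17, 13, 22, 10, 11, 7,
    20, 12, 19, 28, 6, 1, 8, 5, 24, 16, 21, 23, 2]
  exact .of_zmod_listing (v := fun i => ((c i : ZMod 4), binaryVec 3 (c i / 4)))
    (by decide +kernel) (by decide +kernel)

theorem isHarmoniousGroup_zmod_four_prod_binary_four :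
    IsHarmoniousGroup (ZMod 4 × (Fin 4 → ZMod 2)) := by
  let c : ZMod 64 → ℕ := ![0, 26, 43, 7, 13, 5, 25, 3, 36, 19, 10, 32, 20, 56, 63, 12, 17, 40, 23,
    8, 61, 18, 52, 28, 33, 39, 44, 62, 14, 11, 46, 53, 1, 34, 55, 30, 58, 2, 48, 60, 42, 57, 59, 27,
    54, 22, 31, 9, 50, 51, 15, 24, 21, 4, 6, 45, 41, 38, 37, 29, 35, 47, 49, 16]
  exact .of_zmod_listing (v := fun i => ((c i : ZMod 4), binaryVec 4 (c i / 4)))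
    (by decide +kernel) (by decide +kernel)

end SmallGroups

section Rows

variable {G : Type*} [AddCommGroup G] {K : AddSubgroup G}

theorem IsHarmoniousGroup.of_rows {k r : ℕ} [NeZero k] [NeZero r] (hG : Nat.card G = k * r)
    {y : ℕ → ZMod r → G} (hwrap : ∀ a, y k a = y 0 (a + 1))
    (hinj : ∀ ⦃i j⦄, i < k → j < k → ∀ a b, y i a = y j b → i = j ∧ a = b)
    (hadd : ∀ ⦃i j⦄, i < k → j < k → ∀ a b, y i a + y (i + 1) a = y j b + y (j + 1) b →
      i = j ∧ a = b) : IsHarmoniousGroup G := by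
  have hk : 0 < k := NeZero.pos k
  have hsucc (n : ℕ) : y ((n + 1) % k) ((n + 1) / k : ℕ) = y (n % k + 1) (n / k : ℕ) := by
    obtain ⟨q, s, hs, rfl⟩ : ∃ q s, s < k ∧ n = k * q + s :=
      ⟨n / k, n % k, Nat.mod_lt n hk, (Nat.div_add_mod n k).symm⟩
    rw [add_assoc, Nat.mul_add_mod, Nat.mul_add_mod, Nat.mul_add_div hk, Nat.mul_add_div hk,
      Nat.mod_eq_of_lt hs, Nat.div_eq_of_lt hs]
    rcases (Nat.succ_le_of_lt hs).lt_or_eq with hlt | rfl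
    · rw [Nat.mod_eq_of_lt hlt, Nat.div_eq_of_lt hlt]
    · simp [hwrap, Nat.div_self]
  have hcoord {i j : ℕ} (hi : i ∈ Set.Iio (k * r)) (hj : j ∈ Set.Iio (k * r))
      (h : i % k = j % k ∧ ((i / k : ℕ) : ZMod r) = (j / k : ℕ)) : i = j := by
    have hdiv := ((ZMod.natCast_eq_natCast_iff _ _ _).1 h.2).eq_of_lt_of_lt
      (Nat.div_lt_of_lt_mul hi) (Nat.div_lt_of_lt_mul hj)
    rw [← Nat.div_add_mod i k, ← Nat.div_add_mod j k, h.1, hdiv]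
  refine .of_nat_listing hG (h := fun n => y (n % k) (n / k : ℕ)) (by simp [hk]) ?_ ?_
  · exact fun i hi j hj hij => hcoord hi hj (hinj (Nat.mod_lt _ hk) (Nat.mod_lt _ hk) _ _ hij)
  · intro i hi j hj hij
    simp only [hsucc] at hij
    exact hcoord hi hj (hadd (Nat.mod_lt _ hk) (Nat.mod_lt _ hk) _ _ hij)

theorem eq_and_eq_of_injective_sumElim {ι α β : Type*} {f : ι → α → β} {i j : ι}
    (hf : Injective (Sum.elim (f i) (f j))) {m m' : ι} (hm : m = i ∨ m = j)
    (hm' : m' = i ∨ m' = j) {a b : α} (h : f m a = f m' b) : m = m' ∧ a = b := by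
  obtain rfl | rfl := hm <;> obtain rfl | rfl := hm'
  · exact ⟨rfl, Sum.inl_injective (hf (by simpa using h))⟩
  · exact absurd (hf (a₁ := .inl a) (a₂ := .inr b) h) (by simp)
  · exact absurd (hf (a₁ := .inr a) (a₂ := .inl b) h) (by simp)
  · exact ⟨rfl, Sum.inr_injective (hf (by simpa using h))⟩

/-- Four rows of elements of `K` that, when `t` generates `G ⧸ K` and `k = |G ⧸ K|` is even,
combine to a cyclic listing of `G`: the rows `p`, `q`, `p`, `q`, …, `p'`, `q'`, `p'`, `q'`, … on
the cosets `0, 0, t, t, 2 t, 2 t, …` with `k` rows of each of the two kinds. The element `d`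
is `k • t`. -/
structure IsRowSystem {A : Type*} [AddCommGroup A] {r : ℕ} (d : A) (p q p' q' : ZMod r → A) :
    Prop where
  injective_fst : Injective (Sum.elim p q)
  injective_snd : Injective (Sum.elim p' q')
  injective_add : Injective (Sum.elim (p + q) (p' + q' + fun _ => d))
  injective_turn : Injective (Sum.elim (q + p') (q' + fun a => p (a + 1)))

variable {r : ℕ} {t : G} {d : K} {p q p' q' : ZMod r → K}

/-- The `m`-th row of the cyclic listing given by a row system, with the multiple of `t`
subtracted. Row `2 k` is row `0` again, shifted by one place. -/
def rowEntry (p q p' q' : ZMod r → K) (k m : ℕ) : ZMod r → K :=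
  if m < k then (if Even m then p else q) else
    if m < 2 * k then (if Even m then p' else q') else fun a => p (a + 1)

/-- The sum of the rows `m` and `m + 1` of the cyclic listing given by a row system, with the
multiple of `t` subtracted. -/
def rowSum (d : K) (p q p' q' : ZMod r → K) (k m : ℕ) : ZMod r → K :=
  if m + 1 < k then p + q else if m + 1 = k then q + p' else
    if m + 1 < 2 * k then p' + q' + fun _ => d else q' + fun a => p (a + 1)

theorem IsRowSystem.injective_sumElim_rowEntry (h : IsRowSystem d p q p' q') {k b : ℕ}
    (hk : Even k) (hb : b < k) :
    Injective (Sum.elim (rowEntry p q p' q' k (2 * b)) (rowEntry p q p' q' k (2 * b + 1))) := by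
  have heven : Even (2 * b) := even_two_mul b
  have hodd : ¬Even (2 * b + 1) := by simp [parity_simps]
  rcases lt_or_ge (2 * b) k with hlt | hge
  · have hlt' : 2 * b + 1 < k := by grind
    simpa only [rowEntry, hlt, hlt', heven, hodd, if_true, if_false] using h.injective_fst
  · have hge' : ¬2 * b < k := hge.not_gt
    have hge'' : ¬2 * b + 1 < k := by omega
    have hlt : 2 * b < 2 * k := by omega
    have hlt' : 2 * b + 1 < 2 * k := by omega
    simpa only [rowEntry, hge', hge'', hlt, hlt', heven, hodd, if_true, if_false] using
      h.injective_snd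

theorem IsRowSystem.injective_sumElim_rowSum (h : IsRowSystem d p q p' q') {k c : ℕ} (hc : c < k) :
    Injective (Sum.elim (rowSum d p q p' q' k c) (rowSum d p q p' q' k (c + k))) := by
  rcases (Nat.succ_le_of_lt hc).lt_or_eq with hlt | rfl
  · convert h.injective_add using 2 <;> grind [rowSum]
  · convert h.injective_turn using 2 <;> grind [rowSum]

theorem rowSum_eq_rowEntry_add_rowEntry {k m : ℕ} (hk : Even k) (h : m < k ∨ m + 1 = 2 * k) :
    rowSum d p q p' q' k m = rowEntry p q p' q' k m + rowEntry p q p' q' k (m + 1) := by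
  grind [rowSum, rowEntry]

theorem rowSum_eq_rowEntry_add_rowEntry_add {k m : ℕ} (h : k ≤ m) (h' : m + 1 < 2 * k) :
    rowSum d p q p' q' k m =
      rowEntry p q p' q' k m + rowEntry p q p' q' k (m + 1) + fun _ => d := by
  grind [rowSum, rowEntry]

theorem nsmul_add_rowEntry_add {k m : ℕ} (hk : Even k) (hd : k • t = d) (hm : m < 2 * k)
    (a : ZMod r) :
    (m / 2 % k) • t + (rowEntry p q p' q' k m a : G) +
        (((m + 1) / 2 % k) • t + rowEntry p q p' q' k (m + 1) a) =
      (m % k) • t + rowSum d p q p' q' k m a := by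
  have hhalf : m / 2 + (m + 1) / 2 = m := by omega
  rw [add_add_add_comm, ← add_nsmul, Nat.mod_eq_of_lt (show m / 2 < k by omega)]
  rcases lt_or_ge m k with hlt | hge
  · rw [Nat.mod_eq_of_lt (show (m + 1) / 2 < k by omega), hhalf, Nat.mod_eq_of_lt hlt,
      rowSum_eq_rowEntry_add_rowEntry hk (.inl hlt)]
    rfl
  rw [Nat.mod_eq_sub_mod hge, Nat.mod_eq_of_lt (show m - k < k by omega)]
  rcases (Nat.succ_le_of_lt hm).lt_or_eq with hlt | heq
  · have hmk : m = m - k + k := by omega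
    rw [Nat.mod_eq_of_lt (show (m + 1) / 2 < k by omega), hhalf,
      rowSum_eq_rowEntry_add_rowEntry_add hge hlt]
    nth_rw 1 [hmk]
    simp only [add_nsmul, hd, Pi.add_apply, AddSubgroup.coe_add]
    abel
  · have hwrap : (m + 1) / 2 % k = 0 := by simp [← Nat.succ_eq_add_one, heq]
    rw [hwrap, add_zero, show m / 2 = m - k by omega, rowSum_eq_rowEntry_add_rowEntry hk (.inr heq)]
    rfl

theorem IsHarmoniousGroup.of_isRowSystem [NeZero r] (hr : Nat.card K = 2 * r)
    (ht : ∀ x, x ∈ zmultiples (t : G ⧸ K)) (hk : Even (Nat.card (G ⧸ K)))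
    (hk0 : Nat.card (G ⧸ K) ≠ 0) (hd : Nat.card (G ⧸ K) • t = d) (h : IsRowSystem d p q p' q') :
    IsHarmoniousGroup G := by
  have horder := addOrderOf_eq_card_of_forall_mem_zmultiples ht
  set k := Nat.card (G ⧸ K) with hkdef
  have : NeZero (2 * k) := ⟨by omega⟩
  have hlt (n : ℕ) : n % k < addOrderOf (t : G ⧸ K) := horder ▸ Nat.mod_lt n (by omega)
  refine .of_rows (k := 2 * k) (r := r)
    (y := fun m a => (m / 2 % k) • t + (rowEntry p q p' q' k m a : G)) ?_ ?_ ?_ ?_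
  · rw [K.card_eq_card_quotient_mul_card_addSubgroup, hr, ← hkdef]
    ring
  · intro a
    simp [rowEntry, Nat.pos_of_ne_zero hk0]
  · intro i j hi hj a b hab
    obtain ⟨hij, hrow⟩ := eq_and_eq_of_nsmul_add_eq (hlt _) (hlt _) hab
    rw [Nat.mod_eq_of_lt (by omega), Nat.mod_eq_of_lt (by omega)] at hij
    exact eq_and_eq_of_injective_sumElim
      (h.injective_sumElim_rowEntry hk (b := i / 2) (by omega)) (by omega) (by omega) hrow
  · intro i j hi hj a b hab
    simp only [nsmul_add_rowEntry_add hk hd hi, nsmul_add_rowEntry_add hk hd hj] at hab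
    obtain ⟨hij, hrow⟩ := eq_and_eq_of_nsmul_add_eq (hlt _) (hlt _) hab
    have hmod {n : ℕ} (hn : n < 2 * k) : n = n % k ∨ n = n % k + k := by
      rcases lt_or_ge n k with hlt | hge
      · exact .inl (Nat.mod_eq_of_lt hlt).symm
      · rw [Nat.mod_eq_sub_mod hge, Nat.mod_eq_of_lt (by omega)]
        omega
    exact eq_and_eq_of_injective_sumElim
      (h.injective_sumElim_rowSum (c := i % k) (horder ▸ hlt i)) (hmod hi) (hij ▸ hmod hj) hrow

/-- Four pairs of rows which after a translation complete the pair `p`, `q` in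
`exists_isRowSystem` to a row system for every `d`. -/
def completingRows : Fin 4 → (ZMod 4 → ZMod 2 × ZMod 4) × (ZMod 4 → ZMod 2 × ZMod 4) :=
  ![(![(0, 0), (1, 3), (0, 1), (1, 1)], ![(1, 0), (1, 2), (0, 3), (0, 2)]),
    (![(0, 0), (0, 3), (1, 3), (0, 1)], ![(1, 2), (1, 0), (1, 1), (0, 2)]),
    (![(0, 0), (0, 3), (1, 1), (0, 1)], ![(1, 0), (1, 2), (1, 3), (0, 2)]),
    (![(0, 0), (1, 3), (0, 3), (0, 1)], ![(0, 2), (1, 0), (1, 1), (1, 2)])]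

theorem exists_isRowSystem (d : ZMod 2 × ZMod 4) :
    ∃ p q p' q' : ZMod 4 → ZMod 2 × ZMod 4, IsRowSystem d p q p' q' := by
  let p : ZMod 4 → ZMod 2 × ZMod 4 := ![(0, 0), (0, 2), (1, 3), (1, 0)]
  let q : ZMod 4 → ZMod 2 × ZMod 4 := ![(1, 1), (0, 1), (0, 3), (1, 2)]
  have hpq : Injective (Sum.elim p q) := by decide +kernel
  obtain ⟨i, e, h1, h2, h3⟩ : ∃ (i : Fin 4) (e : ZMod 2 × ZMod 4),
      Injective (Sum.elim (fun a => (completingRows i).1 a + e)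
        (fun a => (completingRows i).2 a + e)) ∧
      Injective (Sum.elim (p + q)
        (fun a => (completingRows i).1 a + e + ((completingRows i).2 a + e) + d)) ∧
      Injective (Sum.elim (fun a => q a + ((completingRows i).1 a + e))
        (fun a => (completingRows i).2 a + e + p (a + 1))) := by
    revert d
    decide +kernel
  exact ⟨p, q, _, _, hpq, h1, h2, h3⟩

theorem IsRowSystem.map {A B : Type*} [AddCommGroup A] [AddCommGroup B] {r : ℕ} {d : A}
    {p q p' q' : ZMod r → A} (h : IsRowSystem d p q p' q') {f : A →+ B} (hf : Injective f) :
    IsRowSystem (f d) (f ∘ p) (f ∘ q) (f ∘ p') (f ∘ q') where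
  injective_fst := by simpa only [Sum.comp_elim] using hf.comp h.injective_fst
  injective_snd := by simpa only [Sum.comp_elim] using hf.comp h.injective_snd
  injective_add := by
    convert hf.comp h.injective_add using 1
    rw [Sum.comp_elim]
    congr 1 <;> funext a <;> simp
  injective_turn := by
    convert hf.comp h.injective_turn using 1
    rw [Sum.comp_elim]
    congr 1 <;> funext a <;> simp

theorem IsHarmoniousGroup.of_isAddCyclic_quotient [Finite G] [IsAddCyclic (G ⧸ K)]
    (hk : Even (Nat.card (G ⧸ K))) (e : ZMod 2 × ZMod 4 ≃+ K) : IsHarmoniousGroup G := by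
  obtain ⟨s, hs⟩ := IsAddCyclic.exists_generator (α := G ⧸ K)
  obtain ⟨t, rfl⟩ := QuotientAddGroup.mk_surjective s
  have hmem : Nat.card (G ⧸ K) • t ∈ K := by
    rw [← QuotientAddGroup.eq_zero_iff, QuotientAddGroup.mk_nsmul, card_nsmul_eq_zero']
  obtain ⟨p, q, p', q', h⟩ := exists_isRowSystem (e.symm ⟨_, hmem⟩)
  exact .of_isRowSystem (by simp [← Nat.card_congr e.toEquiv]) hs hk Nat.card_pos.ne'
    (by simp) (h.map (f := e.toAddMonoidHom) e.injective)

end Rows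

section OddMultiples

theorem binaryVec_xor (j a b : ℕ) : binaryVec j (a ^^^ b) = binaryVec j a + binaryVec j b := by
  ext i
  simp only [binaryVec, Nat.testBit_xor, Pi.add_apply]
  cases a.testBit i <;> cases b.testBit i <;> rfl

theorem exists_lt_binaryVec_eq {j : ℕ} (x : Fin j → ZMod 2) : ∃ c < 2 ^ j, binaryVec j c = x := by
  refine ⟨Nat.ofBits fun i => x i = 1, Nat.ofBits_lt_two_pow _, funext fun i => ?_⟩
  have hbit : ∀ a : ZMod 2, (if decide (a = 1) then 1 else 0) = a := by decide
  simp only [binaryVec, Nat.testBit_ofBits_lt _ _ i.2, hbit]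

theorem exists_lt_add_two_mul_eq {k : ℕ} (hk : Odd k) (a : ℤ) (z : ZMod k) :
    ∃ y < k, (a + 2 * y : ZMod k) = z := by
  have : NeZero k := ⟨hk.pos.ne'⟩
  have htwo : IsUnit (2 : ZMod k) := (ZMod.isUnit_iff_coprime 2 k).2 hk.coprime_two_left
  obtain ⟨y, hy⟩ := htwo.dvd (a := z - a)
  exact ⟨y.val, y.val_lt, by rw [ZMod.natCast_zmod_val, ← hy, add_sub_cancel]⟩

theorem injOn_Iio_of_surjective {G : Type*} {n : ℕ} (hn : Nat.card G = n) (hn0 : n ≠ 0)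
    {h : ℕ → G} (hh : ∀ g, ∃ i < n, h i = g) : Set.InjOn h (Set.Iio n) := by
  have : Finite G := Nat.finite_of_card_ne_zero (hn ▸ hn0)
  have hbij : Bijective fun i : Fin n => h i := by
    refine (Nat.bijective_iff_surjective_and_card _).2 ⟨fun g => ?_, by simp [hn]⟩
    obtain ⟨i, hi, hg⟩ := hh g
    exact ⟨⟨i, hi⟩, hg⟩
  exact fun i hi j hj hij =>
    Fin.mk.inj (hbij.injective (a₁ := ⟨i, hi⟩) (a₂ := ⟨j, hj⟩) hij)

/-- Since `2` is invertible modulo the odd number `k`, the values `lo c + 2 * y` with `y < k`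
represent every residue modulo `k`. -/
theorem IsHarmoniousGroup.of_code_level {j k : ℕ} (hk : Odd k) {code : ℕ → ℕ} {level : ℕ → ℤ}
    {lo : ℕ → ℤ} (hcode : code (2 ^ j * k) = code 0) (hlevel : level (2 ^ j * k) = level 0)
    (hvertex : ∀ c < 2 ^ j, ∀ y < k, ∃ i < 2 ^ j * k, ∃ e : ℤ,
      code i = c ∧ level i = y + e * k)
    (hedge : ∀ c < 2 ^ j, ∀ y < k, ∃ i < 2 ^ j * k, ∃ e : ℤ,
      code i ^^^ code (i + 1) = c ∧ level i + level (i + 1) = lo c + 2 * y + e * k) :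
    IsHarmoniousGroup ((Fin j → ZMod 2) × ZMod k) := by
  have : NeZero k := ⟨hk.pos.ne'⟩
  have hcard : Nat.card ((Fin j → ZMod 2) × ZMod k) = 2 ^ j * k := by simp
  refine .of_nat_listing hcard (h := fun i => (binaryVec j (code i), (level i : ZMod k)))
    (by simp only [hcode, hlevel]) (injOn_Iio_of_surjective hcard (NeZero.ne _) ?_)
    (injOn_Iio_of_surjective hcard (NeZero.ne _) ?_)
  · rintro ⟨x, z⟩
    obtain ⟨c, hc, rfl⟩ := exists_lt_binaryVec_eq x
    obtain ⟨i, hi, e, rfl, hz⟩ := hvertex c hc z.val z.val_lt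
    exact ⟨i, hi, Prod.ext rfl (by simp [hz])⟩
  · rintro ⟨x, z⟩
    obtain ⟨c, hc, rfl⟩ := exists_lt_binaryVec_eq x
    obtain ⟨y, hy, rfl⟩ := exists_lt_add_two_mul_eq hk (lo c) z
    obtain ⟨i, hi, e, rfl, hz⟩ := hedge c hc y hy
    exact ⟨i, hi, Prod.ext (binaryVec_xor ..).symm (by
      rw [Prod.snd_add, ← Int.cast_add, hz]; simp)⟩

/-- The part in `Fin 2 → ZMod 2`, written in binary, of the listing of `(Fin 2 → ZMod 2) × ZMod k`
found by arranging translates of the block `1, 2, 3`. -/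
def codeFour (k i : ℕ) : ℕ :=
  if i < 3 * (k - 1) then (if i % 3 = 0 then 1 else if i % 3 = 1 then 2 else 3)
  else if i = 3 * (k - 1) then 3
  else if i = 4 * k - 4 then 2
  else if i = 4 * k - 1 ∨ i = 4 * k then 1 else 0

/-- The part in `ZMod k` of the listing described by `codeFour`. -/
def levelFour (k i : ℕ) : ℤ :=
  if i < 3 * (k - 1) then (if i % 3 = 2 then (i / 3 : ℕ) else (i / 3 : ℕ) + 1)
  else if i = 3 * (k - 1) ∨ i = 4 * k - 2 then -1
  else if i < 4 * k - 4 then i - 3 * k + 3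
  else if i = 4 * k then 1 else 0

theorem exists_codeFour_levelFour {k : ℕ} (hk : 3 ≤ k) : ∀ c < 4, ∀ y < k, ∃ i < 4 * k, ∃ e : ℤ,
    codeFour k i = c ∧ levelFour k i = y + e * k := by
  intro c hc y hy
  interval_cases c
  · rcases y with _ | y
    · exact ⟨4 * k - 3, by omega, 0, by grind [codeFour, levelFour]⟩
    by_cases h : y + 2 < k
    · exact ⟨3 * k - 2 + y, by omega, 0, by grind [codeFour, levelFour]⟩
    · exact ⟨4 * k - 2, by omega, -1, by grind [codeFour, levelFour]⟩
  · rcases y with _ | y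
    · exact ⟨4 * k - 1, by omega, 0, by grind [codeFour, levelFour]⟩
    · exact ⟨3 * y, by omega, 0, by grind [codeFour, levelFour]⟩
  · rcases y with _ | y
    · exact ⟨4 * k - 4, by omega, 0, by grind [codeFour, levelFour]⟩
    · exact ⟨3 * y + 1, by omega, 0, by grind [codeFour, levelFour]⟩
  · by_cases h : y + 1 < k
    · exact ⟨3 * y + 2, by omega, 0, by grind [codeFour, levelFour]⟩
    · exact ⟨3 * k - 3, by omega, -1, by grind [codeFour, levelFour]⟩

theorem exists_codeFour_xor_levelFour_add {k : ℕ} (hk : 3 ≤ k) :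
    ∀ c < 4, ∀ y < k, ∃ i < 4 * k, ∃ e : ℤ, codeFour k i ^^^ codeFour k (i + 1) = c ∧
      levelFour k i + levelFour k (i + 1) = (if c ≤ 1 then -1 else 0) + 2 * y + e * k := by
  intro c hc y hy
  interval_cases c
  · rcases y with _ | _ | y
    · exact ⟨4 * k - 3, by omega, 0, by grind [codeFour, levelFour]⟩
    · exact ⟨4 * k - 1, by omega, 0, by grind [codeFour, levelFour]⟩
    by_cases h : y + 3 < k
    · exact ⟨3 * k - 2 + y, by omega, 0, by grind (splits := 20) [codeFour, levelFour]⟩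
    · exact ⟨3 * k - 4, by omega, -1, by grind [codeFour, levelFour]⟩
  · rcases y with _ | y
    · exact ⟨4 * k - 2, by omega, 0, by grind [codeFour, levelFour]⟩
    · exact ⟨3 * y + 1, by omega, 0, by grind [codeFour, levelFour]⟩
  · rcases y with _ | y
    · exact ⟨4 * k - 4, by omega, 0, by grind [codeFour, levelFour]⟩
    by_cases h : y + 2 < k
    · exact ⟨3 * y + 2, by omega, 0, by grind [codeFour, levelFour]⟩
    · exact ⟨4 * k - 5, by omega, -1, by grind [codeFour, levelFour]⟩
  · rcases y with _ | y
    · exact ⟨3 * k - 3, by omega, 0, by grind [codeFour, levelFour]⟩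
    · exact ⟨3 * y, by omega, 0, by grind [codeFour, levelFour]⟩

theorem isHarmoniousGroup_binary_two_prod_zmod {k : ℕ} (hk : Odd k) (hk3 : 3 ≤ k) :
    IsHarmoniousGroup ((Fin 2 → ZMod 2) × ZMod k) :=
  .of_code_level hk (lo := fun c => if c ≤ 1 then -1 else 0) (by grind [codeFour])
    (by grind [levelFour]) (exists_codeFour_levelFour hk3)
    (exists_codeFour_xor_levelFour_add hk3)

/-- The part in `Fin 3 → ZMod 2`, written in binary, of the listing of `(Fin 3 → ZMod 2) × ZMod k`
found by arranging translates of the block `1, 2, 4, 3, 6, 7, 5`. -/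
def codeEight (k i : ℕ) : ℕ :=
  if i < 7 * (k - 1) then
    match i % 7 with
    | 0 => 1 | 1 => 2 | 2 => 4 | 3 => 3 | 4 => 6 | 5 => 7 | _ => 5
  else if i = 7 * (k - 1) then 5
  else if i < 8 * k - 7 then 0
  else
    match i + 7 - 8 * k with
    | 0 => 4 | 1 => 3 | 2 => 7 | 3 => 6 | 4 => 0 | 5 => 2 | _ => 1

/-- The part in `ZMod k` of the listing described by `codeEight`. -/
def levelEight (k i : ℕ) : ℤ :=
  if i < 7 * (k - 1) then
    (i / 7 : ℕ) + match i % 7 with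
    | 1 => 2 | 4 => 2 | 5 => 2 | _ => 1
  else if i < 8 * k - 7 then i - 7 * (k - 1)
  else
    match i + 7 - 8 * k with
    | 0 => 0 | 1 => 0 | 4 => 0 | 6 => 0 | _ => 1

theorem exists_codeEight_levelEight {k : ℕ} (hk : 3 ≤ k) : ∀ c < 8, ∀ y < k, ∃ i < 8 * k, ∃ e : ℤ,
    codeEight k i = c ∧ levelEight k i = y + e * k := by
  intro c hc y hy
  interval_cases c
  · rcases y with _ | y
    · exact ⟨8 * k - 3, by omega, 0, by grind [codeEight, levelEight]⟩
    · exact ⟨7 * (k - 1) + (y + 1), by omega, 0, by grind [codeEight, levelEight]⟩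
  · rcases y with _ | y
    · exact ⟨8 * k - 1, by omega, 0, by grind [codeEight, levelEight]⟩
    · exact ⟨7 * y, by omega, 0, by grind [codeEight, levelEight]⟩
  · rcases y with _ | _ | y
    · exact ⟨7 * (k - 2) + 1, by omega, 1, by grind [codeEight, levelEight]⟩
    · exact ⟨8 * k - 2, by omega, 0, by grind [codeEight, levelEight]⟩
    · exact ⟨7 * y + 1, by omega, 0, by grind [codeEight, levelEight]⟩
  · rcases y with _ | y
    · exact ⟨8 * k - 6, by omega, 0, by grind [codeEight, levelEight]⟩
    · exact ⟨7 * y + 3, by omega, 0, by grind [codeEight, levelEight]⟩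
  · rcases y with _ | y
    · exact ⟨8 * k - 7, by omega, 0, by grind [codeEight, levelEight]⟩
    · exact ⟨7 * y + 2, by omega, 0, by grind [codeEight, levelEight]⟩
  · rcases y with _ | y
    · exact ⟨7 * (k - 1), by omega, 0, by grind [codeEight, levelEight]⟩
    · exact ⟨7 * y + 6, by omega, 0, by grind [codeEight, levelEight]⟩
  · rcases y with _ | _ | y
    · exact ⟨7 * (k - 2) + 4, by omega, 1, by grind [codeEight, levelEight]⟩
    · exact ⟨8 * k - 4, by omega, 0, by grind [codeEight, levelEight]⟩
    · exact ⟨7 * y + 4, by omega, 0, by grind [codeEight, levelEight]⟩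
  · rcases y with _ | _ | y
    · exact ⟨7 * (k - 2) + 5, by omega, 1, by grind [codeEight, levelEight]⟩
    · exact ⟨8 * k - 5, by omega, 0, by grind [codeEight, levelEight]⟩
    · exact ⟨7 * y + 5, by omega, 0, by grind [codeEight, levelEight]⟩

theorem exists_codeEight_xor_levelEight_add {k : ℕ} (hk : 3 ≤ k) :
    ∀ c < 8, ∀ y < k, ∃ i < 8 * k, ∃ e : ℤ, codeEight k i ^^^ codeEight k (i + 1) = c ∧
      levelEight k i + levelEight k (i + 1) =
        (if c = 1 then 2 else if c = 7 then 0 else 1) + 2 * y + e * k := by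
  intro c hc y hy
  interval_cases c
  · rcases y with _ | y
    · exact ⟨8 * k - 1, by omega, 0, by grind [codeEight, levelEight]⟩
    by_cases h : y + 2 < k
    · exact ⟨7 * (k - 1) + (y + 1), by omega, 0, by grind [codeEight, levelEight]⟩
    · exact ⟨7 * (k - 2) + 6, by omega, -1, by grind [codeEight, levelEight]⟩
  · rcases y with _ | y
    · exact ⟨8 * k - 5, by omega, 0, by grind [codeEight, levelEight]⟩
    · exact ⟨7 * y + 4, by omega, 0, by grind [codeEight, levelEight]⟩
  · rcases y with _ | y
    · exact ⟨8 * k - 3, by omega, 0, by grind [codeEight, levelEight]⟩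
    · exact ⟨7 * y + 5, by omega, 0, by grind [codeEight, levelEight]⟩
  · rcases y with _ | y
    · exact ⟨8 * k - 2, by omega, 0, by grind [codeEight, levelEight]⟩
    · exact ⟨7 * y, by omega, 0, by grind [codeEight, levelEight]⟩
  · rcases y with _ | y
    · exact ⟨8 * k - 6, by omega, 0, by grind [codeEight, levelEight]⟩
    by_cases h : y + 2 < k
    · exact ⟨7 * y + 6, by omega, 0, by grind [codeEight, levelEight]⟩
    · exact ⟨8 * k - 8, by omega, -1, by grind [codeEight, levelEight]⟩
  · rcases y with _ | y
    · exact ⟨7 * (k - 1), by omega, 0, by grind [codeEight, levelEight]⟩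
    · exact ⟨7 * y + 3, by omega, 0, by grind [codeEight, levelEight]⟩
  · rcases y with _ | y
    · exact ⟨8 * k - 4, by omega, 0, by grind [codeEight, levelEight]⟩
    · exact ⟨7 * y + 1, by omega, 0, by grind [codeEight, levelEight]⟩
  · rcases y with _ | y
    · exact ⟨8 * k - 7, by omega, 0, by grind [codeEight, levelEight]⟩
    · exact ⟨7 * y + 2, by omega, 0, by grind [codeEight, levelEight]⟩

theorem isHarmoniousGroup_binary_three_prod_zmod {k : ℕ} (hk : Odd k) (hk3 : 3 ≤ k) :
    IsHarmoniousGroup ((Fin 3 → ZMod 2) × ZMod k) :=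
  .of_code_level hk (lo := fun c => if c = 1 then 2 else if c = 7 then 0 else 1)
    (by grind [codeEight]) (by grind [levelEight]) (exists_codeEight_levelEight hk3)
    (exists_codeEight_xor_levelEight_add hk3)

end OddMultiples

section Doubling

variable {G : Type*} [AddCommGroup G]

/-- The subgroup of elements annihilated by `2`. -/
abbrev twoTorsion (G : Type*) [AddCommGroup G] : AddSubgroup G :=
  (nsmulAddMonoidHom 2 : G →+ G).ker

/-- The subgroup `2G` of all doubles. -/
abbrev doubles (G : Type*) [AddCommGroup G] : AddSubgroup G :=
  (nsmulAddMonoidHom 2 : G →+ G).range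

theorem mem_twoTorsion {x : G} : x ∈ twoTorsion G ↔ 2 • x = 0 := Iff.rfl

theorem index_twoTorsion : (twoTorsion G).index = Nat.card (doubles G) :=
  AddSubgroup.index_ker _

theorem index_doubles [Finite G] : (doubles G).index = Nat.card (twoTorsion G) := by
  have h := (twoTorsion G).card_mul_index.trans (doubles G).card_mul_index.symm
  rw [index_twoTorsion, mul_comm] at h
  exact (Nat.eq_of_mul_eq_mul_left Nat.card_pos h).symm

theorem doubles_quotient (K : AddSubgroup G) :
    doubles (G ⧸ K) = (doubles G).map (QuotientAddGroup.mk' K) := by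
  rw [doubles, doubles, AddMonoidHom.map_range]
  ext x
  simp only [AddMonoidHom.mem_range, (QuotientAddGroup.mk'_surjective K).exists,
    AddMonoidHom.comp_apply, nsmulAddMonoidHom_apply, map_nsmul]

theorem doubles_quotient_eq_bot_iff {K : AddSubgroup G} : doubles (G ⧸ K) = ⊥ ↔ doubles G ≤ K := by
  rw [doubles_quotient, AddSubgroup.map_eq_bot_iff, QuotientAddGroup.ker_mk']

theorem card_twoTorsion_quotient [Finite G] (K : AddSubgroup G) :
    Nat.card (twoTorsion (G ⧸ K)) = (doubles G ⊔ K).index := by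
  rw [← index_doubles, doubles_quotient, AddSubgroup.index_map, QuotientAddGroup.ker_mk',
    AddMonoidHom.range_eq_top.2 (QuotientAddGroup.mk'_surjective K), AddSubgroup.index_top, mul_one]

theorem nonempty_addEquiv_of_elementary [Finite G] (hG : ∀ x : G, 2 • x = 0) :
    ∃ j, Nonempty ((Fin j → ZMod 2) ≃+ G) :=
  let _ := AddCommGroup.zmodModule hG
  ⟨_, ⟨(Module.finBasis (ZMod 2) G).equivFun.symm.toAddEquiv⟩⟩

theorem exists_twoTorsion_addEquiv (G : Type*) [AddCommGroup G] [Finite G] :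
    ∃ j, Nat.card (twoTorsion G) = 2 ^ j ∧ Nonempty ((Fin j → ZMod 2) ≃+ twoTorsion G) := by
  obtain ⟨j, ⟨e⟩⟩ := nonempty_addEquiv_of_elementary (G := twoTorsion G) fun x => Subtype.ext x.2
  exact ⟨j, (Nat.card_congr e.toEquiv).symm.trans (by simp), ⟨e⟩⟩

theorem exists_injective_not_mem_range {F V : Type*} [Field F] [AddCommGroup V] [Module F V]
    [FiniteDimensional F V] {n : ℕ} (hn : n < Module.finrank F V) (t : V) :
    ∃ f : (Fin n → F) →ₗ[F] V, Injective f ∧ ∀ x, f x = t → t = 0 := by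
  have hquot : Module.finrank F (Fin n → F) ≤ Module.finrank F (V ⧸ F ∙ t) := by
    have := (F ∙ t).finrank_quotient_add_finrank
    have hspan : Module.finrank F (F ∙ t) ≤ 1 := by
      simpa using finrank_span_le_card (R := F) ({t} : Set V)
    simp only [Module.finrank_fin_fun]
    omega
  obtain ⟨g, hg⟩ := finrank_le_iff_exists_linearMap.1 hquot
  obtain ⟨s, hs⟩ := (F ∙ t).mkQ.exists_rightInverse_of_surjective (F ∙ t).range_mkQ
  have hmk (x : Fin n → F) : (F ∙ t).mkQ (s (g x)) = g x := LinearMap.congr_fun hs (g x)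
  refine ⟨s ∘ₗ g, fun x y hxy => hg ?_, fun x hx => ?_⟩
  · rw [← hmk x, ← hmk y]
    exact congrArg _ hxy
  · have hgx : g x = 0 := by
      rw [← hmk x, show s (g x) = t from hx]
      simp
    rw [← hx, LinearMap.comp_apply, hgx, map_zero]

theorem exists_le_twoTorsion_not_mem [Finite G] {n : ℕ} (hn : 2 ^ n < Nat.card (twoTorsion G))
    {t : G} (ht : t ≠ 0) :
    ∃ C ≤ twoTorsion G, t ∉ C ∧ Nonempty ((Fin n → ZMod 2) ≃+ C) := by
  obtain ⟨j, hj, ⟨e⟩⟩ := exists_twoTorsion_addEquiv G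
  have hnj : n < Module.finrank (ZMod 2) (Fin j → ZMod 2) := by
    rw [Module.finrank_fin_fun]
    exact (Nat.pow_lt_pow_iff_right one_lt_two).1 (hj ▸ hn)
  obtain ⟨s, hs⟩ : ∃ s : twoTorsion G, t ∈ twoTorsion G → (s : G) = t := by
    by_cases h : t ∈ twoTorsion G
    exacts [⟨⟨t, h⟩, fun _ => rfl⟩, ⟨0, fun h' => absurd h' h⟩]
  obtain ⟨f, hf, hft⟩ := exists_injective_not_mem_range hnj (e.symm s)
  let φ : (Fin n → ZMod 2) →+ G :=
    ((twoTorsion G).subtype.comp e.toAddMonoidHom).comp f.toAddMonoidHom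
  have hφinj : Injective φ := Subtype.val_injective.comp (e.injective.comp hf)
  refine ⟨φ.range, ?_, ?_, ⟨AddMonoidHom.ofInjective hφinj⟩⟩
  · rintro _ ⟨x, rfl⟩
    exact (e (f x)).2
  · rintro ⟨x, hx⟩
    have hmem : t ∈ twoTorsion G := hx ▸ (e (f x)).2
    have hfx : f x = e.symm s := by
      rw [AddEquiv.eq_symm_apply]
      exact Subtype.ext (hx.trans (hs hmem).symm)
    apply ht
    rw [← hs hmem, ← e.apply_symm_apply s, hft x hfx, map_zero, ZeroMemClass.coe_zero]

end Doubling

section InternalSum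

variable {G : Type*} [AddCommGroup G]

theorem nonempty_prod_addEquiv_sup {A B : AddSubgroup G} (h : Disjoint A B) :
    Nonempty (A × B ≃+ ↥(A ⊔ B)) := by
  let f : A × B →+ G := A.subtype.coprod B.subtype
  have hinj : Injective f := (injective_iff_map_eq_zero f).2 fun ⟨a, b⟩ hab => by
    have heq : (a : G) = -b := eq_neg_of_add_eq_zero_left hab
    have ha : (a : G) = 0 := AddSubgroup.disjoint_def.1 h a.2 (heq ▸ neg_mem b.2)
    exact Prod.ext (Subtype.ext ha) (Subtype.ext (neg_eq_zero.1 (heq ▸ ha)))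
  have hrange : f.range = A ⊔ B := by
    ext x
    simp only [AddMonoidHom.mem_range, Prod.exists, AddSubgroup.mem_sup, f]
    exact ⟨fun ⟨a, b, hab⟩ => ⟨a, a.2, b, b.2, hab⟩,
      fun ⟨a, ha, b, hb, hab⟩ => ⟨⟨a, ha⟩, ⟨b, hb⟩, hab⟩⟩
  exact ⟨(AddMonoidHom.ofInjective hinj).trans (AddEquiv.addSubgroupCongr hrange)⟩

theorem card_sup_of_disjoint {A B : AddSubgroup G} (h : Disjoint A B) :
    Nat.card ↥(A ⊔ B) = Nat.card A * Nat.card B := by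
  obtain ⟨e⟩ := nonempty_prod_addEquiv_sup h
  rw [← Nat.card_congr e.toEquiv, Nat.card_prod]

theorem nonempty_prod_addEquiv [Finite G] {A B : AddSubgroup G} (h : Disjoint A B)
    (hcard : Nat.card A * Nat.card B = Nat.card G) : Nonempty (A × B ≃+ G) := by
  obtain ⟨e⟩ := nonempty_prod_addEquiv_sup h
  have htop : A ⊔ B = ⊤ := AddSubgroup.eq_top_of_card_eq _ (by rw [card_sup_of_disjoint h, hcard])
  exact ⟨e.trans ((AddEquiv.addSubgroupCongr htop).trans AddSubgroup.topEquiv)⟩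

theorem nonempty_zmod_addEquiv_zmultiples (u : G) :
    Nonempty (ZMod (addOrderOf u) ≃+ zmultiples u) := by
  rw [← Nat.card_zmultiples]
  exact ⟨zmodAddCyclicAddEquiv inferInstance⟩

theorem index_le_card_mul_index_sup [Finite G] (A K : AddSubgroup G) :
    A.index ≤ Nat.card K * (A ⊔ K).index := by
  rw [← AddSubgroup.relIndex_mul_index (le_sup_left : A ≤ A ⊔ K), AddSubgroup.relIndex_sup_left]
  exact Nat.mul_le_mul_right _ (Nat.le_of_dvd Nat.card_pos (AddSubgroup.index_dvd_card _))

end InternalSum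

section Quotients

variable {G : Type*} [AddCommGroup G] [Finite G]

theorem even_index_of_doubles_le {A : AddSubgroup G} (hA : doubles G ≤ A) (h : A ≠ ⊤) :
    Even A.index := by
  obtain ⟨j, hj, -⟩ := exists_twoTorsion_addEquiv (G ⧸ A)
  rw [card_twoTorsion_quotient, sup_eq_right.2 hA] at hj
  have hj0 : j ≠ 0 := by
    rintro rfl
    exact h (AddSubgroup.index_eq_one.1 hj)
  exact hj ▸ (even_two.pow_of_ne_zero hj0)

theorem even_card_quotient {K : AddSubgroup G} (h : doubles G ⊔ K ≠ ⊤) : Even (Nat.card (G ⧸ K)) :=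
  (even_iff_two_dvd.1 (even_index_of_doubles_le le_sup_left h)).trans
    (AddSubgroup.index_dvd_of_le le_sup_right) |> even_iff_two_dvd.2

/-- The induction hypothesis in the construction of harmonious listings: the quotients of `G` by
nontrivial subgroups that have more than two elements annihilated by `2`, but also elements not
annihilated by `2`, are harmonious. -/
def HasHarmoniousQuotients (G : Type*) [AddCommGroup G] : Prop :=
  ∀ K : AddSubgroup G, K ≠ ⊥ → 2 < (doubles G ⊔ K).index → ¬doubles G ≤ K →
    IsHarmoniousGroup (G ⧸ K)

theorem HasHarmoniousQuotients.of_hasCompleteCycle_two (h : HasHarmoniousQuotients G)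
    {K : AddSubgroup G} (hK : K ≠ ⊥) (hindex : 2 < (doubles G ⊔ K).index) (hle : ¬doubles G ≤ K)
    (hcycle : HasCompleteCycle K 2) : IsHarmoniousGroup G := by
  have htop : doubles G ⊔ K ≠ ⊤ := fun htop => by simp [htop] at hindex
  exact .of_quotient K (h K hK hindex hle)
    (hcycle.of_even (even_card_quotient htop) Nat.card_pos.ne')

theorem HasHarmoniousQuotients.of_le_card_twoTorsion (h : HasHarmoniousQuotients G)
    (hG : doubles G ≠ ⊥) (hT : 64 ≤ Nat.card (twoTorsion G)) : IsHarmoniousGroup G := by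
  obtain ⟨t, htG, ht⟩ := (doubles G).bot_or_exists_ne_zero.resolve_left hG
  obtain ⟨K, -, htK, ⟨e⟩⟩ := exists_le_twoTorsion_not_mem (n := 4) (by omega) ht
  have hcard : Nat.card K = 16 := (Nat.card_congr e.toEquiv).symm.trans (by simp)
  have hindex := index_le_card_mul_index_sup (doubles G) K
  rw [index_doubles, hcard] at hindex
  refine h.of_hasCompleteCycle_two ?_ (by omega) (fun hle => htK (hle htG))
    (hasCompleteCycle_two_sixteen.congr e)
  rintro rfl
  simp at hcard

end Quotients

section OddPart

variable {G : Type*} [AddCommGroup G] [Finite G]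

theorem isHarmoniousGroup_of_doubles_eq_zmultiples {g : G} (hg : Odd (addOrderOf g)) (hg0 : g ≠ 0)
    (hG : doubles G = zmultiples g) (hT : 2 < Nat.card (twoTorsion G))
    (hT' : Nat.card (twoTorsion G) < 64) : IsHarmoniousGroup G := by
  have hquot : Nat.card (G ⧸ twoTorsion G) = addOrderOf g := by
    rw [← AddSubgroup.index_eq_card, index_twoTorsion, hG, Nat.card_zmultiples]
  have hg1 : addOrderOf g ≠ 1 := by rwa [Ne, AddMonoid.addOrderOf_eq_one_iff]
  have hg3 : 3 ≤ addOrderOf g := by grind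
  obtain ⟨j, hj, ⟨eT⟩⟩ := exists_twoTorsion_addEquiv G
  have hdisj : Disjoint (twoTorsion G) (zmultiples g) := by
    apply AddSubgroup.disjoint_of_coprime_natCard
    rw [hj, Nat.card_zmultiples]
    exact hg.coprime_two_left.pow_left j
  obtain ⟨e⟩ := nonempty_prod_addEquiv hdisj (by
    rw [Nat.card_zmultiples, ← hquot, ← AddSubgroup.index_eq_card, AddSubgroup.card_mul_index])
  obtain ⟨ez⟩ := nonempty_zmod_addEquiv_zmultiples g
  rw [← hquot] at hg1
  have hodd : Odd (Nat.card (G ⧸ twoTorsion G)) := hquot ▸ hg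
  have hj1 : 1 < j := (Nat.pow_lt_pow_iff_right one_lt_two).1 (hj ▸ hT)
  have hj6 : j < 6 := (Nat.pow_lt_pow_iff_right one_lt_two).1 (hj ▸ hT')
  interval_cases j
  · exact (isHarmoniousGroup_binary_two_prod_zmod hg hg3).congr ((eT.prodCongr ez).trans e)
  · exact (isHarmoniousGroup_binary_three_prod_zmod hg hg3).congr ((eT.prodCongr ez).trans e)
  · exact .of_quotient _ (.of_odd_card hodd)
      ((hasCompleteCycle_three_sixteen.congr eT).of_odd hodd hg1)
  · exact .of_quotient _ (.of_odd_card hodd)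
      ((hasCompleteCycle_three_thirtyTwo.congr eT).of_odd hodd hg1)

theorem HasHarmoniousQuotients.of_odd_prime_dvd_card (h : HasHarmoniousQuotients G)
    (hT : 2 < Nat.card (twoTorsion G)) (hT' : Nat.card (twoTorsion G) < 64) {p : ℕ} (hp : p.Prime)
    (hp2 : p ≠ 2) (hpG : p ∣ Nat.card G) : IsHarmoniousGroup G := by
  have : Fact p.Prime := ⟨hp⟩
  obtain ⟨g, rfl⟩ := exists_prime_addOrderOf_dvd_card' p hpG
  have hodd : Odd (addOrderOf g) := hp.odd_of_ne_two hp2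
  have hg0 : g ≠ 0 := by rintro rfl; simp [Nat.not_prime_one] at hp
  have hle : zmultiples g ≤ doubles G := by
    rw [AddSubgroup.zmultiples_le]
    obtain ⟨m, hm⟩ := hodd
    refine ⟨(m + 1) • g, ?_⟩
    rw [nsmulAddMonoidHom_apply, ← mul_nsmul', show 2 * (m + 1) = addOrderOf g + 1 by omega,
      succ_nsmul, addOrderOf_nsmul_eq_zero, zero_add]
  by_cases hG : doubles G ≤ zmultiples g
  · exact isHarmoniousGroup_of_doubles_eq_zmultiples hodd hg0 (hG.antisymm hle) hT hT'
  · refine .of_quotient _ (h _ (by simpa using hg0) ?_ hG)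
      (hasCompleteCycle_of_isAddCyclic (by rwa [Nat.card_zmultiples]) Nat.card_pos.ne')
    rwa [sup_eq_left.2 hle, index_doubles]

end OddPart

section OrderFour

variable {G : Type*} [AddCommGroup G]

theorem addOrderOf_eq_four {u : G} (h2 : 2 • u ≠ 0) (h4 : 4 • u = 0) : addOrderOf u = 4 :=
  addOrderOf_eq_prime_pow (p := 2) (n := 1) (by simpa using h2) (by simpa using h4)

theorem two_nsmul_ne_zero_of_addOrderOf_eq_four {u : G} (hu : addOrderOf u = 4) : 2 • u ≠ 0 :=
  fun h => by simpa [hu] using addOrderOf_dvd_of_nsmul_eq_zero h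

theorem two_nsmul_mem_twoTorsion {u : G} (hu : addOrderOf u = 4) : 2 • u ∈ twoTorsion G := by
  rw [mem_twoTorsion, smul_smul, show 2 * 2 = addOrderOf u by omega, addOrderOf_nsmul_eq_zero]

theorem disjoint_zmultiples {A : AddSubgroup G} {w : G} (hw : w ∈ twoTorsion G) (hwA : w ∉ A) :
    Disjoint (zmultiples w) A := by
  rw [AddSubgroup.disjoint_def]
  rintro _ ⟨a, rfl⟩ haA
  have hw2 : (2 : ℤ) • w = 0 := by exact_mod_cast hw
  obtain ⟨b, rfl | rfl⟩ := a.even_or_odd'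
  · simp only [mul_comm, mul_smul, hw2, smul_zero]
  · have heq : (2 * b + 1) • w = w := by rw [add_smul, mul_comm, mul_smul, hw2]; simp
    exact absurd (heq ▸ haA) hwA

theorem zmultiples_inf_twoTorsion_le {u : G} (hu : addOrderOf u = 4) :
    zmultiples u ⊓ twoTorsion G ≤ zmultiples (2 • u) := by
  rintro _ ⟨⟨a, rfl⟩, ha⟩
  have hdvd : (4 : ℤ) ∣ 2 * a := by
    rw [← Nat.cast_ofNat, ← hu, addOrderOf_dvd_iff_zsmul_eq_zero, mul_smul]
    exact_mod_cast ha
  obtain ⟨b, rfl⟩ : (2 : ℤ) ∣ a := by omega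
  exact ⟨b, by simp only [mul_comm (2 : ℤ), mul_smul, ofNat_zsmul]⟩

theorem addOrderOf_eq_two {w : G} (hw : w ∈ twoTorsion G) (hw0 : w ≠ 0) : addOrderOf w = 2 :=
  addOrderOf_eq_prime hw hw0

theorem nonempty_addEquiv_zmultiples_sup {u w : G} (hu : addOrderOf u = 4) (hw : w ∈ twoTorsion G)
    (hwu : w ∉ zmultiples u) : Nonempty (ZMod 2 × ZMod 4 ≃+ ↥(zmultiples w ⊔ zmultiples u)) := by
  have hw0 : w ≠ 0 := fun h => hwu (h ▸ zero_mem _)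
  obtain ⟨eu⟩ := nonempty_zmod_addEquiv_zmultiples u
  obtain ⟨ew⟩ := nonempty_zmod_addEquiv_zmultiples w
  rw [hu] at eu
  rw [addOrderOf_eq_two hw hw0] at ew
  obtain ⟨e⟩ := nonempty_prod_addEquiv_sup (disjoint_zmultiples hw hwu)
  exact ⟨(ew.prodCongr eu).trans e⟩

theorem card_zmultiples_sup {u w : G} (hu : addOrderOf u = 4) (hw : w ∈ twoTorsion G)
    (hwu : w ∉ zmultiples u) : Nat.card ↥(zmultiples w ⊔ zmultiples u) = 8 := by
  obtain ⟨e⟩ := nonempty_addEquiv_zmultiples_sup hu hw hwu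
  exact (Nat.card_congr e.toEquiv).symm.trans (by simp)

variable [Finite G]

theorem exists_mem_twoTorsion_not_mem {A : AddSubgroup G} {u : G} (hu : addOrderOf u = 4)
    (huA : u ∈ A) (hA : Nat.card A < 2 * Nat.card (twoTorsion G)) :
    ∃ w ∈ twoTorsion G, w ∉ A := by
  by_contra! hle
  have hle : twoTorsion G ≤ A := hle
  obtain ⟨c, hc⟩ := AddSubgroup.card_dvd_of_le hle
  have hpos : 0 < Nat.card A := Nat.card_pos
  obtain rfl : c = 1 := by
    have : c < 2 := by
      rw [hc, mul_comm] at hA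
      exact Nat.lt_of_mul_lt_mul_right hA
    have : c ≠ 0 := by rintro rfl; simp [hc] at hpos
    omega
  have heq : twoTorsion G = A := AddSubgroup.eq_of_le_of_card_ge hle (by rw [hc, mul_one])
  exact two_nsmul_ne_zero_of_addOrderOf_eq_four hu (heq ▸ huA : u ∈ twoTorsion G)

theorem odd_card_of_card_twoTorsion_eq_one (hT : Nat.card (twoTorsion G) = 1) :
    Odd (Nat.card G) := by
  by_contra heven
  obtain ⟨x, hx⟩ := exists_prime_addOrderOf_dvd_card' 2
    (even_iff_two_dvd.1 (Nat.not_odd_iff_even.1 heven))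
  have hxT : x ∈ twoTorsion G := by rw [mem_twoTorsion, ← hx, addOrderOf_nsmul_eq_zero]
  rw [AddSubgroup.card_eq_one.1 hT, AddSubgroup.mem_bot] at hxT
  simp [hxT] at hx

theorem eq_top_of_doubles_sup_eq_top {a : ℕ} (hG : Nat.card G = 2 ^ a) {A : AddSubgroup G}
    (h : doubles G ⊔ A = ⊤) : A = ⊤ := by
  have hodd : Odd (Nat.card (G ⧸ A)) := odd_card_of_card_twoTorsion_eq_one (by
    rw [card_twoTorsion_quotient, h, AddSubgroup.index_top])
  rw [← AddSubgroup.index_eq_one, AddSubgroup.index_eq_card]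
  exact Nat.Coprime.eq_one_of_dvd (hodd.coprime_two_right.pow_right a)
    (hG ▸ AddSubgroup.card_quotient_dvd_card A)

theorem isAddCyclic_of_index_doubles_le_two {a : ℕ} (hG : Nat.card G = 2 ^ a)
    (h : (doubles G).index ≤ 2) : IsAddCyclic G := by
  obtain ⟨x, hx⟩ : ∃ x, doubles G ⊔ zmultiples x = ⊤ := by
    by_cases htop : doubles G = ⊤
    · exact ⟨0, by simp [htop]⟩
    obtain ⟨x, -, hx⟩ := SetLike.exists_of_lt (lt_top_iff_ne_top.2 htop)
    have hlt : doubles G < doubles G ⊔ zmultiples x := by simpa [left_lt_sup] using hx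
    have hindex := (AddSubgroup.index_strictAnti hlt).trans_le h
    have hne : (doubles G ⊔ zmultiples x).index ≠ 0 := AddSubgroup.index_ne_zero_of_finite
    exact ⟨x, AddSubgroup.index_eq_one.1 (by omega)⟩
  have hgen := eq_top_of_doubles_sup_eq_top hG hx
  exact ⟨x, fun y => AddSubgroup.mem_zmultiples_iff.1 (hgen ▸ AddSubgroup.mem_top y)⟩

theorem exists_addOrderOf_eq_four {a : ℕ} (hcard : Nat.card G = 2 ^ a) (hG : doubles G ≠ ⊥) :
    ∃ u : G, addOrderOf u = 4 := by
  obtain ⟨_, ⟨x, rfl⟩, hx⟩ := (doubles G).bot_or_exists_ne_zero.resolve_left hG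
  obtain ⟨b, -, hb⟩ := (Nat.dvd_prime_pow Nat.prime_two).1 (hcard ▸ addOrderOf_dvd_natCard x)
  have hb2 : 2 ≤ b := by
    by_contra! hlt
    refine hx (addOrderOf_dvd_iff_nsmul_eq_zero.1 ?_)
    rw [hb]
    exact pow_dvd_pow 2 (by omega : b ≤ 1)
  obtain ⟨c, hc⟩ : 4 ∣ addOrderOf x := hb ▸ pow_dvd_pow 2 hb2
  have hc0 : c ≠ 0 := by
    rintro rfl
    exact (addOrderOf_pos x).ne' hc
  exact ⟨c • x, by rw [addOrderOf_nsmul_of_dvd hc0 (hc ▸ dvd_mul_left c 4), hc,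
    Nat.mul_div_cancel _ (Nat.pos_of_ne_zero hc0)]⟩

end OrderFour

section TwoGroups

/-- Every internal direct sum of a subgroup of order `2` and a cyclic subgroup of order `4` of `G`
contains `2G`: no copy of `ZMod 2 × ZMod 4` can be factored out in the induction. -/
def DoublesLeSups (G : Type*) [AddCommGroup G] : Prop :=
  ∀ u w : G, addOrderOf u = 4 → w ∈ twoTorsion G → w ∉ zmultiples u →
    doubles G ≤ zmultiples w ⊔ zmultiples u

variable {G : Type*} [AddCommGroup G] [Finite G] {u : G}

theorem exists_mem_twoTorsion_not_mem_zmultiples (hu : addOrderOf u = 4)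
    (hT : 2 < Nat.card (twoTorsion G)) : ∃ w ∈ twoTorsion G, w ∉ zmultiples u :=
  exists_mem_twoTorsion_not_mem hu (AddSubgroup.mem_zmultiples u)
    (by rw [Nat.card_zmultiples]; omega)

theorem DoublesLeSups.le_zmultiples (h : DoublesLeSups G) (hT : 4 < Nat.card (twoTorsion G))
    (hu : addOrderOf u = 4) : doubles G ≤ zmultiples u := by
  obtain ⟨w, hw, hwu⟩ := exists_mem_twoTorsion_not_mem_zmultiples hu (by omega)
  obtain ⟨v, hv, hvwu⟩ := exists_mem_twoTorsion_not_mem (A := zmultiples w ⊔ zmultiples u) hu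
    (AddSubgroup.mem_sup_right (AddSubgroup.mem_zmultiples u))
    (by rw [card_zmultiples_sup hu hw hwu]; omega)
  have hvu : v ∉ zmultiples u := fun hv' => hvwu (AddSubgroup.mem_sup_right hv')
  intro x hx
  obtain ⟨y, hy, z, hz, rfl⟩ := AddSubgroup.mem_sup.1 (h u v hu hv hvu hx)
  have hymem : y ∈ zmultiples w ⊔ zmultiples u := by
    simpa using sub_mem (h u w hu hw hwu hx) (AddSubgroup.mem_sup_right hz)
  have hy0 : y = 0 := AddSubgroup.disjoint_def.1 (disjoint_zmultiples hv hvwu) hy hymem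
  rwa [hy0, zero_add]

theorem DoublesLeSups.le_zmultiples_two_nsmul (h : DoublesLeSups G)
    (hT : 4 < Nat.card (twoTorsion G)) (hu : addOrderOf u = 4) :
    doubles G ≤ zmultiples (2 • u) := by
  obtain ⟨w, hw, hwu⟩ := exists_mem_twoTorsion_not_mem_zmultiples hu (by omega)
  have huw : addOrderOf (u + w) = 4 := by
    have heq : 2 • (u + w) = 2 • u := by rw [smul_add, mem_twoTorsion.1 hw, add_zero]
    apply addOrderOf_eq_four
    · exact heq ▸ two_nsmul_ne_zero_of_addOrderOf_eq_four hu
    · rw [show 4 = 2 * 2 from rfl, mul_smul, heq]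
      exact two_nsmul_mem_twoTorsion hu
  intro x hx
  obtain ⟨c, rfl : c • (u + w) = x⟩ := h.le_zmultiples hT huw hx
  have hcw : c • w = 0 := by
    refine AddSubgroup.disjoint_def.1 (disjoint_zmultiples hw hwu)
      (AddSubgroup.zsmul_mem_zmultiples w c) ?_
    simpa using sub_mem (h.le_zmultiples hT hu hx) (AddSubgroup.zsmul_mem_zmultiples u c)
  have hw0 : w ≠ 0 := fun hw0 => hwu (hw0 ▸ zero_mem _)
  obtain ⟨d, rfl⟩ : (2 : ℤ) ∣ c := by
    simpa [addOrderOf_eq_two hw hw0] using addOrderOf_dvd_iff_zsmul_eq_zero.2 hcw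
  rw [smul_add, hcw, add_zero, mul_comm, mul_smul, ofNat_zsmul]
  exact AddSubgroup.zsmul_mem_zmultiples _ d

theorem DoublesLeSups.card_doubles_lt (h : DoublesLeSups G) (hT : 2 < Nat.card (twoTorsion G))
    (hu : addOrderOf u = 4) : Nat.card (doubles G) < 8 := by
  by_contra! hcard
  obtain ⟨w, hw, hwu⟩ := exists_mem_twoTorsion_not_mem_zmultiples hu hT
  have heq : doubles G = zmultiples w ⊔ zmultiples u :=
    AddSubgroup.eq_of_le_of_card_ge (h u w hu hw hwu) (by rwa [card_zmultiples_sup hu hw hwu])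
  have hw0 : w ≠ 0 := fun hw0 => hwu (hw0 ▸ zero_mem _)
  obtain ⟨v, hv⟩ : w ∈ doubles G :=
    heq ▸ AddSubgroup.mem_sup_left (AddSubgroup.mem_zmultiples w)
  rw [nsmulAddMonoidHom_apply] at hv
  have hv4 : addOrderOf v = 4 := addOrderOf_eq_four (by rwa [hv])
    (by rw [show 4 = 2 * 2 from rfl, mul_smul, hv]; exact hw)
  have huv : 2 • u ∉ zmultiples v := by
    intro huv
    refine two_nsmul_ne_zero_of_addOrderOf_eq_four hu ?_
    refine AddSubgroup.disjoint_def.1 (disjoint_zmultiples hw hwu) ?_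
      (AddSubgroup.nsmul_mem_zmultiples u 2)
    exact hv ▸ zmultiples_inf_twoTorsion_le hv4 ⟨huv, two_nsmul_mem_twoTorsion hu⟩
  have hvmem : v ∈ doubles G := by
    rw [AddSubgroup.eq_of_le_of_card_ge (h v _ hv4 (two_nsmul_mem_twoTorsion hu) huv)
      (by rwa [card_zmultiples_sup hv4 (two_nsmul_mem_twoTorsion hu) huv])]
    exact AddSubgroup.mem_sup_right (AddSubgroup.mem_zmultiples v)
  rw [heq] at hvmem
  obtain ⟨_, ⟨a, rfl⟩, z, hz, hvz⟩ := AddSubgroup.mem_sup.1 hvmem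
  refine hwu ?_
  rw [← hv, ← hvz, smul_add, smul_comm, mem_twoTorsion.1 hw, smul_zero, zero_add]
  exact AddSubgroup.nsmul_mem _ hz 2

theorem DoublesLeSups.card_doubles_le (h : DoublesLeSups G) {a : ℕ} (hcard : Nat.card G = 2 ^ a)
    (hT : 2 < Nat.card (twoTorsion G)) (hu : addOrderOf u = 4) : Nat.card (doubles G) ≤ 4 := by
  obtain ⟨d, -, hd⟩ := (Nat.dvd_prime_pow Nat.prime_two).1
    (hcard ▸ (doubles G).card_addSubgroup_dvd_card)
  have hd3 : 2 ^ d < 2 ^ 3 := hd ▸ h.card_doubles_lt hT hu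
  have hd2 : d ≤ 2 := Nat.lt_succ_iff.1 ((Nat.pow_lt_pow_iff_right one_lt_two).1 hd3)
  exact hd ▸ Nat.pow_le_pow_right two_pos hd2

theorem isHarmoniousGroup_of_doubles_le_zmultiples_two_nsmul (hu : addOrderOf u = 4)
    (hle : doubles G ≤ zmultiples (2 • u)) (hT : 8 < Nat.card (twoTorsion G))
    (hT' : Nat.card (twoTorsion G) < 64) : IsHarmoniousGroup G := by
  have hu0 := two_nsmul_ne_zero_of_addOrderOf_eq_four hu
  have hcard : 2 * Nat.card (twoTorsion G) = Nat.card G := by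
    have heq : doubles G = zmultiples (2 • u) :=
      hle.antisymm (AddSubgroup.zmultiples_le.2 ⟨u, rfl⟩)
    rw [← (twoTorsion G).index_mul_card, index_twoTorsion, heq, Nat.card_zmultiples,
      addOrderOf_eq_two (two_nsmul_mem_twoTorsion hu) hu0]
  have split {n : ℕ} (hn : Nat.card (twoTorsion G) = 2 * 2 ^ n) :
      Nonempty (ZMod 4 × (Fin n → ZMod 2) ≃+ G) := by
    obtain ⟨C, hCT, huC, ⟨eC⟩⟩ := exists_le_twoTorsion_not_mem (n := n) (by omega) hu0
    have hdisj : Disjoint (zmultiples u) C := by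
      rw [AddSubgroup.disjoint_def]
      exact fun hxu hxC => AddSubgroup.disjoint_def.1
        (disjoint_zmultiples (two_nsmul_mem_twoTorsion hu) huC)
        (zmultiples_inf_twoTorsion_le hu ⟨hxu, hCT hxC⟩) hxC
    obtain ⟨e⟩ := nonempty_prod_addEquiv hdisj (by
      rw [Nat.card_zmultiples, hu, ← Nat.card_congr eC.toEquiv, ← hcard, hn, Nat.card_fun]
      simp [← mul_assoc])
    obtain ⟨eu⟩ := nonempty_zmod_addEquiv_zmultiples u
    rw [hu] at eu
    exact ⟨(eu.prodCongr eC).trans e⟩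
  obtain ⟨j, hj, -⟩ := exists_twoTorsion_addEquiv G
  have hj3 : 3 < j := (Nat.pow_lt_pow_iff_right one_lt_two).1 (hj ▸ hT)
  have hj6 : j < 6 := (Nat.pow_lt_pow_iff_right one_lt_two).1 (hj ▸ hT')
  interval_cases j
  · obtain ⟨e⟩ := split (n := 3) hj
    exact isHarmoniousGroup_zmod_four_prod_binary_three.congr e
  · obtain ⟨e⟩ := split (n := 4) hj
    exact isHarmoniousGroup_zmod_four_prod_binary_four.congr e

theorem IsHarmoniousGroup.of_index_sup_le_two {a : ℕ} (hcard : Nat.card G = 2 ^ a)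
    {K : AddSubgroup G} (e : ZMod 2 × ZMod 4 ≃+ K) (hK : (doubles G ⊔ K).index ≤ 2) :
    IsHarmoniousGroup G := by
  obtain ⟨b, -, hb⟩ := (Nat.dvd_prime_pow Nat.prime_two).1
    (hcard ▸ AddSubgroup.card_quotient_dvd_card K)
  have : IsAddCyclic (G ⧸ K) := isAddCyclic_of_index_doubles_le_two hb (by
    rwa [index_doubles, card_twoTorsion_quotient])
  by_cases htop : doubles G ⊔ K = ⊤
  · obtain rfl := eq_top_of_doubles_sup_eq_top hcard htop
    exact isHarmoniousGroup_zmod_two_prod_zmod_four.congr (e.trans AddSubgroup.topEquiv)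
  · exact .of_isAddCyclic_quotient (even_card_quotient htop) e

theorem two_lt_index_sup_of_not_isHarmoniousGroup {a : ℕ} (hcard : Nat.card G = 2 ^ a)
    (hG : ¬IsHarmoniousGroup G) {u w : G} (hu : addOrderOf u = 4) (hw : w ∈ twoTorsion G)
    (hwu : w ∉ zmultiples u) : 2 < (doubles G ⊔ (zmultiples w ⊔ zmultiples u)).index := by
  obtain ⟨e⟩ := nonempty_addEquiv_zmultiples_sup hu hw hwu
  by_contra! hle
  exact hG (.of_index_sup_le_two hcard e hle)

theorem HasHarmoniousQuotients.doublesLeSups (h : HasHarmoniousQuotients G) {a : ℕ}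
    (hcard : Nat.card G = 2 ^ a) (hG : ¬IsHarmoniousGroup G) : DoublesLeSups G := by
  intro u w hu hw hwu
  obtain ⟨e⟩ := nonempty_addEquiv_zmultiples_sup hu hw hwu
  by_contra hle
  refine hG (h.of_hasCompleteCycle_two ?_
    (two_lt_index_sup_of_not_isHarmoniousGroup hcard hG hu hw hwu) hle
    (hasCompleteCycle_zmod_two_prod_zmod_four.congr e))
  intro hbot
  simpa [hbot] using card_zmultiples_sup hu hw hwu

theorem HasHarmoniousQuotients.of_card_eq_two_pow (h : HasHarmoniousQuotients G) {a : ℕ}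
    (hcard : Nat.card G = 2 ^ a) (hG : doubles G ≠ ⊥) (hT : 2 < Nat.card (twoTorsion G))
    (hT' : Nat.card (twoTorsion G) < 64) : IsHarmoniousGroup G := by
  by_contra hnot
  have hsups : DoublesLeSups G := h.doublesLeSups hcard hnot
  obtain ⟨u, hu⟩ := exists_addOrderOf_eq_four hcard hG
  obtain ⟨w, hw, hwu⟩ := exists_mem_twoTorsion_not_mem_zmultiples hu hT
  have hindex : 2 < (zmultiples w ⊔ zmultiples u).index := by
    simpa only [sup_eq_right.2 (hsups u w hu hw hwu)] using
      two_lt_index_sup_of_not_isHarmoniousGroup hcard hnot hu hw hwu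
  have hprod : Nat.card (twoTorsion G) * Nat.card (doubles G) =
      8 * (zmultiples w ⊔ zmultiples u).index := by
    rw [← card_zmultiples_sup hu hw hwu, AddSubgroup.card_mul_index, ← index_twoTorsion,
      AddSubgroup.card_mul_index]
  have hD : Nat.card (doubles G) ≤ 4 := hsups.card_doubles_le hcard hT hu
  have hT4 : 4 < Nat.card (twoTorsion G) := by nlinarith
  have hle := hsups.le_zmultiples_two_nsmul hT4 hu
  have hD2 : Nat.card (doubles G) ≤ 2 := by
    refine (AddSubgroup.card_le_of_le hle).trans_eq ?_
    rw [Nat.card_zmultiples, addOrderOf_eq_two (two_nsmul_mem_twoTorsion hu)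
      (two_nsmul_ne_zero_of_addOrderOf_eq_four hu)]
  exact hnot (isHarmoniousGroup_of_doubles_le_zmultiples_two_nsmul hu hle (by nlinarith) hT')

end TwoGroups

section Induction

theorem IsHarmoniousGroup.of_two_lt_card_twoTorsion {G : Type*} [AddCommGroup G] [Finite G]
    (hT : 2 < Nat.card (twoTorsion G)) (hG : doubles G ≠ ⊥) : IsHarmoniousGroup G := by
  induction hn : Nat.card G using Nat.strong_induction_on generalizing G with
  | _ n ih =>
  subst hn
  have hquot : HasHarmoniousQuotients G := fun K hK hindex hle =>
    ih (Nat.card (G ⧸ K)) (card_quotient_lt hK) (by rwa [card_twoTorsion_quotient])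
      (mt doubles_quotient_eq_bot_iff.1 hle) rfl
  by_cases hT' : Nat.card (twoTorsion G) < 64
  · by_cases hp : ∃ p, p.Prime ∧ p ≠ 2 ∧ p ∣ Nat.card G
    · obtain ⟨p, hp, hp2, hpG⟩ := hp
      exact hquot.of_odd_prime_dvd_card hT hT' hp hp2 hpG
    · push Not at hp
      exact hquot.of_card_eq_two_pow
        (Nat.eq_prime_pow_of_unique_prime_dvd Nat.card_pos.ne'
          fun hd hdG => by_contra fun h2 => hp _ hd h2 hdG) hG hT hT'
  · exact hquot.of_le_card_twoTorsion hG (not_lt.1 hT')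

theorem two_lt_card_twoTorsion_of_mem {G : Type*} [AddCommGroup G] [Finite G] {x y : G}
    (hx : x ∈ twoTorsion G) (hy : y ∈ twoTorsion G) (hx0 : x ≠ 0) (hy0 : y ≠ 0) (hxy : x ≠ y) :
    2 < Nat.card (twoTorsion G) := by
  change 2 < Set.ncard (twoTorsion G : Set G)
  rw [Set.two_lt_ncard_iff]
  exact ⟨0, x, y, zero_mem _, hx, hy, hx0.symm, hy0.symm, hxy⟩

theorem IsHarmoniousGroup.of_injective_zmod_two_prod_zmod {G : Type*} [AddCommGroup G] [Finite G]
    {s : ℕ} (hs : 2 ≤ s) {f : ZMod 2 × ZMod (2 * s) →+ G} (hf : Injective f) :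
    IsHarmoniousGroup G := by
  have hcast {a : ℕ} (ha : 0 < a) (has : a < 2 * s) : (a : ZMod (2 * s)) ≠ 0 := by
    rw [Ne, ZMod.natCast_eq_zero_iff]
    exact Nat.not_dvd_of_pos_of_lt ha has
  have htorsion {x} (hx : 2 • x = 0) : f x ∈ twoTorsion G := by
    rw [mem_twoTorsion, ← map_nsmul, hx, map_zero]
  have hne {x} (hx : x ≠ 0) : f x ≠ 0 := mt (map_eq_zero_iff f hf).1 hx
  have hs0 : (s : ZMod (2 * s)) ≠ 0 := hcast (by omega) (by omega)
  have hxT : (2 • (1, 0) : ZMod 2 × ZMod (2 * s)) = 0 :=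
    Prod.ext (show (2 • 1 : ZMod 2) = 0 by decide) (smul_zero 2)
  have hyT : (2 • (0, (s : ZMod (2 * s))) : ZMod 2 × ZMod (2 * s)) = 0 := by
    refine Prod.ext (smul_zero 2) ?_
    rw [Prod.smul_snd, Prod.snd_zero, nsmul_eq_mul, ← Nat.cast_mul, ZMod.natCast_self]
  apply IsHarmoniousGroup.of_two_lt_card_twoTorsion
  · exact two_lt_card_twoTorsion_of_mem (htorsion hxT) (htorsion hyT) (hne (by simp))
      (hne (by simp [hs0])) (hf.ne (by simp))
  · intro hbot
    have hmem : f (2 • (0, 1)) ∈ doubles G := by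
      rw [map_nsmul]
      exact ⟨_, rfl⟩
    rw [hbot, AddSubgroup.mem_bot] at hmem
    refine hne ?_ hmem
    have h20 : (2 : ZMod (2 * s)) ≠ 0 := by exact_mod_cast hcast two_pos (by omega)
    simpa using h20

theorem CycleCondition.isHarmoniousGroup {n : ℕ} (hn : n ≠ 0) {H : Type*} [AddCommGroup H]
    (hH : CycleCondition n H) : IsHarmoniousGroup H := by
  obtain ⟨rfl, hodd | ⟨-, s, hs, L, ⟨e⟩⟩⟩ := hH
  · exact .of_odd_card hodd
  · have : Finite H := Nat.finite_of_card_ne_zero hn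
    exact .of_injective_zmod_two_prod_zmod hs (f := L.subtype.comp e.symm.toAddMonoidHom)
      (Subtype.val_injective.comp e.symm.injective)

end Induction

section OpenWeb

theorem generalizedOpenWeb_adj_none_some {m n : ℕ} {y : Fin m × Fin n} :
    (generalizedOpenWeb m n).Adj none (some y) ↔ (y.1 : ℕ) = 0 := by
  rw [generalizedOpenWeb, SimpleGraph.deleteEdges_adj]
  refine ⟨And.left, fun h => ⟨h, ?_⟩⟩
  rintro ⟨i, a, b, -, -, hab⟩
  simp at hab

theorem generalizedPrism_adj {m n : ℕ} {x y : Fin m × Fin n} :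
    (generalizedPrism m n).Adj x y ↔
      ((x.1 : ℕ) + 1 = y.1 ∨ (y.1 : ℕ) + 1 = x.1) ∧ x.2 = y.2 ∨
        (SimpleGraph.cycleGraph n).Adj x.2 y.2 ∧ x.1 = y.1 := by
  rw [generalizedPrism, SimpleGraph.boxProd_adj, SimpleGraph.pathGraph_adj]

theorem mk_some_some_mem_bottomCycleEdges {m n : ℕ} {x y : Fin m × Fin n} :
    s(some x, some y) ∈ bottomCycleEdges m n ↔
      (SimpleGraph.cycleGraph n).Adj x.2 y.2 ∧ x.1 = y.1 ∧ (x.1 : ℕ) + 1 = m := by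
  obtain ⟨i, a⟩ := x
  obtain ⟨j, b⟩ := y
  constructor
  · rintro ⟨i', a', b', hi', hab, heq⟩
    simp only [Sym2.eq_iff, Option.some.injEq, Prod.mk.injEq] at heq
    obtain ⟨⟨rfl, rfl⟩, rfl, rfl⟩ | ⟨⟨rfl, rfl⟩, rfl, rfl⟩ := heq
    exacts [⟨hab, rfl, hi'⟩, ⟨hab.symm, rfl, hi'⟩]
  · rintro ⟨hab, rfl, hi⟩
    exact ⟨i, a, b, hi, hab, rfl⟩

theorem generalizedOpenWeb_adj_some_some {m n : ℕ} {x y : Fin m × Fin n} :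
    (generalizedOpenWeb m n).Adj (some x) (some y) ↔
      ((x.1 : ℕ) + 1 = y.1 ∨ (y.1 : ℕ) + 1 = x.1) ∧ x.2 = y.2 ∨
        (SimpleGraph.cycleGraph n).Adj x.2 y.2 ∧ x.1 = y.1 ∧ (x.1 : ℕ) + 1 ≠ m := by
  rw [generalizedOpenWeb, SimpleGraph.deleteEdges_adj, mk_some_some_mem_bottomCycleEdges]
  change (generalizedPrism m n).Adj x y ∧ _ ↔ _
  rw [generalizedPrism_adj]
  have hne (h : x.1 = y.1) : ¬((x.1 : ℕ) + 1 = y.1 ∨ (y.1 : ℕ) + 1 = x.1) := by simp [h]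
  tauto

/-- The edges of `OW_{l + 1, k + 2}`: those of the `l` remaining cycles, those of the copies of the
path, and those at the added vertex. -/
def openWebEdge (l k : ℕ) : (Fin l × Fin (k + 2)) ⊕ (Fin l × Fin (k + 2)) ⊕ Fin (k + 2) →
    Sym2 (Option (Fin (l + 1) × Fin (k + 2)))
  | .inl (i, j) => s(some (i.castSucc, j), some (i.castSucc, j + 1))
  | .inr (.inl (i, j)) => s(some (i.castSucc, j), some (i.succ, j))
  | .inr (.inr j) => s(none, some (0, j))

theorem openWebEdge_mem_edgeSet {l k : ℕ} (x) :
    openWebEdge l k x ∈ (generalizedOpenWeb (l + 1) (k + 2)).edgeSet := by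
  rcases x with ⟨i, j⟩ | ⟨i, j⟩ | j
  · refine generalizedOpenWeb_adj_some_some.2 (.inr ⟨?_, rfl, ?_⟩)
    · exact SimpleGraph.cycleGraph_adj.2 (.inr (add_sub_cancel_left _ _))
    · simpa using i.2.ne
  · exact generalizedOpenWeb_adj_some_some.2 (.inl ⟨.inl (by simp), rfl⟩)
  · exact generalizedOpenWeb_adj_none_some.2 rfl

theorem mk_path_mem_range_openWebEdge {l k : ℕ} {a b : Fin (l + 1)} (h : (a : ℕ) + 1 = b)
    (j : Fin (k + 2)) : s(some (a, j), some (b, j)) ∈ Set.range (openWebEdge l k) := by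
  have ha : (a : ℕ) < l := by omega
  obtain rfl : b = Fin.succ ⟨a, ha⟩ := Fin.ext h.symm
  exact ⟨.inr (.inl (⟨a, ha⟩, j)), rfl⟩

theorem mk_cycle_mem_range_openWebEdge {l k : ℕ} {a : Fin (l + 1)} (h : (a : ℕ) + 1 ≠ l + 1)
    {j j' : Fin (k + 2)} (hj : j' - j = 1) :
    s(some (a, j), some (a, j')) ∈ Set.range (openWebEdge l k) := by
  refine ⟨.inl (⟨a, by omega⟩, j), ?_⟩
  rw [openWebEdge, ← hj, add_sub_cancel]
  rfl

theorem mem_range_openWebEdge {l k : ℕ} {e}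
    (he : e ∈ (generalizedOpenWeb (l + 1) (k + 2)).edgeSet) :
    e ∈ Set.range (openWebEdge l k) := by
  have apex {y : Fin (l + 1) × Fin (k + 2)} (hy : (y.1 : ℕ) = 0) :
      s(none, some y) ∈ Set.range (openWebEdge l k) :=
    ⟨.inr (.inr y.2), by rw [openWebEdge, ← show y.1 = 0 from Fin.ext hy]⟩
  induction e using Sym2.ind with
  | _ x y =>
  rw [SimpleGraph.mem_edgeSet] at he
  rcases x with _ | ⟨i, j⟩ <;> rcases y with _ | ⟨i', j'⟩
  · exact absurd he (SimpleGraph.irrefl _)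
  · exact apex (generalizedOpenWeb_adj_none_some.1 he)
  · rw [Sym2.eq_swap]
    exact apex (generalizedOpenWeb_adj_none_some.1 he.symm)
  · obtain ⟨hii', rfl : j = j'⟩ | ⟨hjj', rfl : i = i', hi⟩ :=
      generalizedOpenWeb_adj_some_some.1 he
    · rcases hii' with h | h
      · exact mk_path_mem_range_openWebEdge h j
      · rw [Sym2.eq_swap]
        exact mk_path_mem_range_openWebEdge h j
    · rcases SimpleGraph.cycleGraph_adj.1 hjj' with h | h
      · rw [Sym2.eq_swap]
        exact mk_cycle_mem_range_openWebEdge hi h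
      · exact mk_cycle_mem_range_openWebEdge hi h

theorem exists_fin_listing_of_isCycleOn {α : Type*} {n : ℕ} (hn : Nat.card α = n + 1) {σ : Perm α}
    (hσ : σ.IsCycleOn Set.univ) :
    ∃ v : Fin (n + 1) → α, Bijective v ∧ ∀ j, v (j + 1) = σ (v j) := by
  have hfin : Finite α := Nat.finite_of_card_ne_zero (by omega)
  cases nonempty_fintype α
  have hne : Nonempty α := Finite.card_pos_iff.1 (by omega)
  obtain ⟨a⟩ := hne
  rw [← Finset.coe_univ] at hσ
  rw [Nat.card_eq_fintype_card, ← Finset.card_univ] at hn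
  have hmod {i j : ℕ} : (σ ^ i) a = (σ ^ j) a ↔ i ≡ j [MOD n + 1] :=
    hn ▸ hσ.pow_apply_eq_pow_apply (Finset.mem_univ a)
  refine ⟨fun j => (σ ^ (j : ℕ)) a, ⟨fun i j hij => ?_, fun x => ?_⟩, fun j => ?_⟩
  · exact Fin.ext ((hmod.1 hij).eq_of_lt_of_lt i.2 j.2)
  · obtain ⟨j, hj, rfl⟩ := hσ.exists_pow_eq (Finset.mem_univ a) (Finset.mem_univ x)
    exact ⟨⟨j, hn ▸ hj⟩, rfl⟩
  · rw [← Perm.mul_apply, ← pow_succ', hmod, Fin.val_add, Nat.ModEq, Nat.mod_mod, Fin.val_one']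
    simp

/-- The labelling of `OW_{l + 1, k + 2}` given by a permutation `σ` of a subgroup `H`, a cyclic
arrangement `v` of the elements of `H` and an element `t` of `Γ`. Going down one level turns the
arrangement by one step; this makes the labels of the edges between the levels `i` and `i + 1` run
through the sums `x + σ x` in the coset `(2 i + 1) t + H`, just as those of the edges of the level
`i` do in the coset `2 i t + H`. -/
def openWebLabel {Γ : Type*} [AddCommGroup Γ] {H : AddSubgroup Γ} (l : ℕ) {k : ℕ} (t : Γ)
    (σ : Perm H) (v : Fin (k + 2) → H) : Option (Fin (l + 1) × Fin (k + 2)) → Γ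
  | none => (2 * l) • t
  | some (i, j) => (i : ℕ) • t + ((σ ^ (i : ℕ)) (v j) : H)

section openWebLabel

variable {Γ : Type*} [AddCommGroup Γ] {H : AddSubgroup Γ} {l k : ℕ} {t : Γ} {σ : Perm H}
  {v : Fin (k + 2) → H}

theorem openWebLabel_injective (hl : 0 < l) (ht : addOrderOf (t : Γ ⧸ H) = 2 * l + 1)
    (hv : Injective v) : Injective (openWebLabel l t σ v) := by
  have apex_ne (i : Fin (l + 1)) (x : H) : (2 * l) • t ≠ (i : ℕ) • t + x := fun h => by
    have := (eq_and_eq_of_nsmul_add_eq (H := H) (x := 0) (by omega) (by omega)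
      ((add_zero _).trans h)).1
    omega
  rintro (_ | ⟨i, j⟩) (_ | ⟨i', j'⟩) h
  · rfl
  · exact (apex_ne _ _ h).elim
  · exact (apex_ne _ _ h.symm).elim
  · obtain ⟨hi, hj⟩ := eq_and_eq_of_nsmul_add_eq (by omega) (by omega) h
    obtain rfl := Fin.ext hi
    rw [hv ((σ ^ (i : ℕ)).injective hj)]

theorem edgeLabel_openWebEdge_injective (ht : addOrderOf (t : Γ ⧸ H) = 2 * l + 1)
    (hv : Injective v) (hσv : ∀ j, v (j + 1) = σ (v j)) (hadd : Injective fun x => x + σ x) :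
    Injective fun e => edgeLabel (openWebLabel l t σ v) (openWebEdge l k e) := by
  have hcycle (i : Fin l) (j) : edgeLabel (openWebLabel l t σ v) (openWebEdge l k (.inl (i, j))) =
      (2 * (i : ℕ)) • t + ((σ ^ (i : ℕ)) (v j) + σ ((σ ^ (i : ℕ)) (v j)) : H) := by
    simp only [edgeLabel, openWebEdge, Sym2.lift_mk, openWebLabel, Fin.val_castSucc, hσv,
      two_mul, add_nsmul, AddSubgroup.coe_add, ← Perm.mul_apply, ← pow_succ, ← pow_succ']
    abel
  have hpath (i : Fin l) (j) :
      edgeLabel (openWebLabel l t σ v) (openWebEdge l k (.inr (.inl (i, j)))) =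
        (2 * (i : ℕ) + 1) • t + ((σ ^ (i : ℕ)) (v j) + σ ((σ ^ (i : ℕ)) (v j)) : H) := by
    simp only [edgeLabel, openWebEdge, Sym2.lift_mk, openWebLabel, Fin.val_castSucc, Fin.val_succ,
      two_mul, add_nsmul, AddSubgroup.coe_add, ← Perm.mul_apply, ← pow_succ']
    abel
  have hapex (j) : edgeLabel (openWebLabel l t σ v) (openWebEdge l k (.inr (.inr j))) =
      (2 * l) • t + (v j : Γ) := by
    simp [edgeLabel, openWebEdge, openWebLabel]
  rintro (⟨i, j⟩ | ⟨i, j⟩ | j) (⟨i', j'⟩ | ⟨i', j'⟩ | j') h <;>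
    simp only [hcycle, hpath, hapex] at h <;>
    obtain ⟨hi, hj⟩ := eq_and_eq_of_nsmul_add_eq (by omega) (by omega) h <;>
    first
    | omega
    | obtain rfl : i = i' := Fin.ext (by omega)
      rw [hv ((σ ^ (i : ℕ)).injective (hadd hj))]
    | rw [hv hj]

theorem isHarmoniousLabeling_openWebLabel (hl : 0 < l)
    (hΓ : Nat.card Γ = (2 * l + 1) * (k + 2)) (ht : addOrderOf (t : Γ ⧸ H) = 2 * l + 1)
    (hv : Injective v) (hσv : ∀ j, v (j + 1) = σ (v j)) (hadd : Injective fun x => x + σ x) :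
    IsHarmoniousLabeling (generalizedOpenWeb (l + 1) (k + 2)) (openWebLabel l t σ v) := by
  have hinj := edgeLabel_openWebEdge_injective ht hv hσv hadd
  refine ⟨openWebLabel_injective hl ht hv, ?_, fun y => ?_⟩
  · rintro ⟨_, he⟩ ⟨_, he'⟩ h
    obtain ⟨x, rfl⟩ := mem_range_openWebEdge he
    obtain ⟨x', rfl⟩ := mem_range_openWebEdge he'
    exact Subtype.ext (congrArg (openWebEdge l k) (hinj h))
  · have hfin : Finite Γ := Nat.finite_of_card_ne_zero (by rw [hΓ]; positivity)
    have hcard : Nat.card Γ ≤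
        Nat.card ((Fin l × Fin (k + 2)) ⊕ (Fin l × Fin (k + 2)) ⊕ Fin (k + 2)) := by
      simp only [hΓ, Nat.card_sum, Nat.card_prod, Nat.card_fin]
      apply le_of_eq
      ring
    obtain ⟨x, hx⟩ := (hinj.bijective_of_nat_card_le hcard).surjective y
    exact ⟨⟨_, openWebEdge_mem_edgeSet x⟩, hx⟩

end openWebLabel

theorem isHarmonious_generalizedOpenWeb {m n : ℕ} (hm : 2 ≤ m) (hn : 2 ≤ n) {Γ : Type*}
    [AddCommGroup Γ] {H : AddSubgroup Γ} (hcard : Nat.card H = n)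
    (hquot : Nat.card (Γ ⧸ H) = 2 * m - 1) (hcyc : IsAddCyclic (Γ ⧸ H))
    (hH : IsHarmoniousGroup H) : IsHarmonious (generalizedOpenWeb m n) Γ := by
  obtain ⟨l, rfl⟩ : ∃ l, m = l + 1 := ⟨m - 1, by omega⟩
  obtain ⟨k, rfl⟩ : ∃ k, n = k + 2 := ⟨n - 2, by omega⟩
  replace hquot : Nat.card (Γ ⧸ H) = 2 * l + 1 := hquot.trans (by omega)
  have hΓ : Nat.card Γ = (2 * l + 1) * (k + 2) := by
    rw [H.card_eq_card_quotient_mul_card_addSubgroup, hquot, hcard]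
  obtain ⟨s, hs⟩ := hcyc.exists_generator
  obtain ⟨t, rfl⟩ := QuotientAddGroup.mk_surjective s
  have ht := (addOrderOf_eq_card_of_forall_mem_zmultiples hs).trans hquot
  obtain ⟨σ, hσ, hadd⟩ := hH
  obtain ⟨v, hv, hσv⟩ := exists_fin_listing_of_isCycleOn hcard hσ
  exact ⟨_, isHarmoniousLabeling_openWebLabel (by omega) hΓ ht hv.injective hσv hadd⟩

end OpenWeb

end GammaHarmonious

theorem mainTheorem5 (n m : ℕ) (hn : 3 ≤ n) (hm : 2 ≤ m) (Γ : Type*) [AddCommGroup Γ]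
    (hΓ : Nat.card Γ = (2 * m - 1) * n) (H : AddSubgroup Γ)
    (hH : GammaHarmonious.CycleCondition n H) (hcyc : IsAddCyclic (Γ ⧸ H)) :
    GammaHarmonious.IsHarmonious (GammaHarmonious.generalizedOpenWeb m n) Γ := by
  have hquot : Nat.card (Γ ⧸ H) = 2 * m - 1 :=
    Nat.eq_of_mul_eq_mul_right (by omega : 0 < n)
      (by rw [← hΓ, H.card_eq_card_quotient_mul_card_addSubgroup, hH.1])
  exact GammaHarmonious.isHarmonious_generalizedOpenWeb hm (by omega) hH.1 hquot hcyc
    (hH.isHarmoniousGroup (by omega))
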